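/- Let $d\ge 1$, let $I_\pm=\{\pm1,\dots,\pm d\}$ index the canonical basis $(|\tau\rangle)_{\tau\in I_\pm}$ of $\mathbb C^{2d}$, and let $r:I_\pm\to\mathbb Z^d$ be any function, with mean $\overline r=\frac1{2d}\sum_{\tau}r(\tau)\in\mathbb R^d$. Let $C(\omega)$ be a random unitary matrix in $M_{2d}(\mathbb C)$ on a probability space $(\Omega,\mu)$, and let $C_k=C(\omega_k)$, $k\ge1$, be i.i.d. copies on the product space $(\Omega^{\mathbb N^*},\mu^{\otimes\mathbb N^*})$, with expectation $\mathbb E$. On $\mathbb C^{2d}\otimes\ell^2(\mathbb Z^d)$ let $$S=\sum_{x\in\mathbb Z^d}\sum_{\tau\in I_\pm}|\tau\rangle\langle\tau|\otimes|x+r(\tau)\rangle\langle x|,\qquad U_k=S\,(C_k\otimes\mathbb I),\qquad U(n,0)=U_n\cdots U_1 .$$ For a unit vector $\varphi_0\in\mathbb C^{2d}$ and $\psi_0=\varphi_0\otimes|0\rangle$ put $$w_k(n)=\mathbb E\,\langle\psi_0|U(n,0)^*(\mathbb I\otimes|k\rangle\langle k|)U(n,0)\psi_0\rangle\quad(k\in\mathbb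 Z^d),$$ $$\Phi_n(y)=\sum_{k}w_k(n)e^{iy\cdot k}\quad(y\in\mathbb C^d),\qquad \langle f(X)\rangle(n)=\sum_k f(k)\,w_k(n)$$ (all these sums are finite). Products such as $y\cdot k$ and $\langle y,Ay\rangle=\sum_{i,j}y_iA_{ij}y_j$ are bilinear, without complex conjugation, for $y\in\mathbb C^d$. Let $\mathbb T^d=[0,2\pi)^d$ and $d\tilde v=dv/(2\pi)^d$. On $\mathbb C^{2d}\otimes\mathbb C^{2d}$ let $$\mathcal M(y,y')=D(y,y')\,\mathbb E[C\otimes\overline C],\qquad D(y,y')\,|\tau\otimes\tau'\rangle=e^{i(y\cdot r(\tau)+y'\cdot r(\tau'))}|\tau\otimes\tau'\rangle .$$ **Assumption S.** For every $v\in\mathbb T^d$, $1$ is the only eigenvalue of $\mathcal M(-v,v)$ on the unit circle, and it is simple (algebraic multiplicity one). Let $P=|\Psi_0\rangle\langle\Psi_0|$ with $\Psi_0=(2d)^{-1/2}\sum_\tau|\tau\otimes\tau\rangle$. Under Assumption S this is the spectral projector of $\mathcal M(-v,v)$ for the eigenvalue $1$. Let $S_v(1)$ be the corresponding reduced resolvent,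 i.e. the value at $z=1$ of the analytic extension of $(\mathcal M(-v,v)-z)^{-1}-\frac{P}{1-z}$. Define the symmetric matrix $\mathbb D(v)$ by $$\mathbb D_{ij}(v)=\overline r_i\overline r_j-\frac1{2d}\sum_{\tau}r_i(\tau)r_j(\tau)-\frac1{2d}\sum_{\tau,\tau'}\bigl(r_i(\tau)r_j(\tau')+r_j(\tau)r_i(\tau')\bigr)\langle\tau\otimes\tau|S_v(1)\,\tau'\otimes\tau'\rangle .$$ **Theorem.** Suppose Assumption S holds. Then, jointly uniformly for $y$ in compact subsets of $\mathbb C^d$ and $t$ in compact subsets of $(0,\infty)$, $$\lim_{n\to\infty}\Phi_{[tn]}(y/n)=e^{it\,y\cdot\overline r},\qquad \lim_{n\to\infty}e^{-i[tn]\,\overline r\cdot y/\sqrt n}\,\Phi_{[tn]}(y/\sqrt n)=\int_{\mathbb T^d}e^{-\frac t2\langle y,\mathbb D(v)y\rangle}\,d\tilde v ,$$ and the last integral is an analytic function of $(t,y)\in\mathbb C\times\mathbb C^d$. Moreover, for all $i,j\in\{1,\dots,d\}$, $$\lim_{n\to\infty}\frac{\langle X_i\rangle(n)}n=\overline r_i,\qquad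 \lim_{n\to\infty}\frac{\langle(X-n\overline r)_i(X-n\overline r)_j\rangle(n)}n=\int_{\mathbb T^d}\mathbb D_{ij}(v)\,d\tilde v ,$$ and for every $s=(s_1,\dots,s_d)\in\mathbb N^d$, with $|s|=s_1+\dots+s_d$, $$\lim_{n\to\infty}\frac{\langle X_1^{s_1}\cdots X_d^{s_d}\rangle(n)}{n^{|s|}}=\overline r_1^{\,s_1}\cdots\overline r_d^{\,s_d},$$ $$\lim_{n\to\infty}\frac{\langle(X-n\overline r)_1^{s_1}\cdots(X-n\overline r)_d^{s_d}\rangle(n)}{n^{|s|/2}}=(-i)^{|s|}\int_{\mathbb T^d}\Bigl(\partial_{y_1}^{s_1}\cdots\partial_{y_d}^{s_d}\,e^{-\frac12\langle y,\mathbb D(v)y\rangle}\Bigr)\Big|_{y=0}\,d\tilde v .$$ -/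

import Mathlib

open MeasureTheory Filter Topology
open scoped Matrix Kronecker BigOperators

namespace RandomQW

noncomputable section

/-- The set `I_± = {±1, …, ±d}` of labels of the coin states: the pair `(j, ε)` stands for the
label `ε (j + 1)`. It has `2 d` elements. -/
abbrev CoinIdx (d : ℕ) : Type := Fin d × ℤˣ

/-- The coin space `ℂ^{2d}`, with its canonical (orthonormal) basis indexed by `I_±`. -/
abbrev CoinSpace (d : ℕ) : Type := EuclideanSpace ℂ (CoinIdx d)

/-- The Hilbert space `ℂ^{2d} ⊗ ℓ²(ℤ^d)` of the walker, realised as `ℓ²(ℤ^d; ℂ^{2d})`. -/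
abbrev WalkerSpace (d : ℕ) : Type := lp (fun _ : Fin d → ℤ => CoinSpace d) 2

theorem memlp_two_iff {d : ℕ} (f : (Fin d → ℤ) → CoinSpace d) :
    Memℓp f 2 ↔ Summable fun x => ‖f x‖ ^ 2 := by
  rw [memℓp_gen_iff (by norm_num)]
  simp

theorem memlp_coin {d : ℕ} (C : Matrix (CoinIdx d) (CoinIdx d) ℂ) (ψ : WalkerSpace d) :
    Memℓp (fun x => Matrix.toEuclideanLin C (ψ x)) 2 := by
  have h := (memlp_two_iff _).1 ψ.2
  rw [memlp_two_iff]
  let L := LinearMap.toContinuousLinearMap (Matrix.toEuclideanLin C)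
  refine Summable.of_nonneg_of_le (fun _ => by positivity) (fun x => ?_) (h.mul_left (‖L‖ ^ 2))
  rw [← mul_pow]
  exact pow_le_pow_left₀ (norm_nonneg _) (L.le_opNorm (ψ x)) 2

/-- The operator `C ⊗ 𝕀` acting on the internal degree of freedom. -/
def coinOp {d : ℕ} (C : Matrix (CoinIdx d) (CoinIdx d) ℂ) :
    WalkerSpace d →ₗ[ℂ] WalkerSpace d where
  toFun ψ := ⟨fun x => Matrix.toEuclideanLin C (ψ x), memlp_coin C ψ⟩
  map_add' ψ χ := by ext x : 2; exact (Matrix.toEuclideanLin C).map_add (ψ x) (χ x)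
  map_smul' c ψ := by ext x : 2; exact (Matrix.toEuclideanLin C).map_smul c (ψ x)

theorem memlp_shift {d : ℕ} (r : CoinIdx d → Fin d → ℤ) (ψ : WalkerSpace d) :
    Memℓp (fun x => (WithLp.toLp 2 fun τ => ψ (x - r τ) τ : CoinSpace d)) 2 := by
  have h := (memlp_two_iff _).1 ψ.2
  rw [memlp_two_iff]
  simp only [EuclideanSpace.norm_sq_eq]
  refine summable_sum fun τ _ => ?_
  have h2 : Summable fun x : Fin d → ℤ => ‖ψ (x - r τ)‖ ^ 2 :=
    h.comp_injective (i := fun x : Fin d → ℤ => x - r τ) (sub_left_injective)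
  refine Summable.of_nonneg_of_le (fun _ => by positivity) (fun x => ?_) h2
  exact pow_le_pow_left₀ (norm_nonneg _) (PiLp.norm_apply_le (ψ (x - r τ)) τ) 2

/-- The conditional shift `S = ∑ₓ ∑_τ P_τ ⊗ |x + r(τ)⟩⟨x|` with jump function `r`. -/
def shiftOp {d : ℕ} (r : CoinIdx d → Fin d → ℤ) : WalkerSpace d →ₗ[ℂ] WalkerSpace d where
  toFun ψ := ⟨fun x => WithLp.toLp 2 fun τ => ψ (x - r τ) τ, memlp_shift r ψ⟩
  map_add' ψ χ := by ext x : 2; rfl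
  map_smul' c ψ := by ext x : 2; rfl

/-- The evolution `U(n,0) = U_n ⋯ U_1` with `U_k = S (C_k ⊗ 𝕀)`; the coin matrix `C_k` is the
entry of index `k - 1` of the sequence `C`. -/
def evolution {d : ℕ} (r : CoinIdx d → Fin d → ℤ)
    (C : ℕ → Matrix (CoinIdx d) (CoinIdx d) ℂ) : ℕ → WalkerSpace d →ₗ[ℂ] WalkerSpace d
  | 0 => LinearMap.id
  | n + 1 => (shiftOp r ∘ₗ coinOp (C n)) ∘ₗ evolution r C n

/-- `W_k(n) = ⟨U(n,0) ψ₀, (𝕀 ⊗ |k⟩⟨k|) U(n,0) ψ₀⟩` for the initial state `ψ₀ = φ₀ ⊗ |0⟩`. -/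
def prob {d : ℕ} (r : CoinIdx d → Fin d → ℤ) (C : ℕ → Matrix (CoinIdx d) (CoinIdx d) ℂ)
    (φ₀ : CoinSpace d) (n : ℕ) (k : Fin d → ℤ) : ℝ :=
  ‖evolution r C n (lp.single 2 (0 : Fin d → ℤ) φ₀) k‖ ^ 2

/-- After `n` steps the walker lives in a finite set that does not depend on the coins, so that
every sum over `ℤ^d` below is in fact a finite sum. -/
theorem exists_finset_prob_eq_zero {d : ℕ} (r : CoinIdx d → Fin d → ℤ) (φ₀ : CoinSpace d)
    (n : ℕ) : ∃ F : Finset (Fin d → ℤ), ∀ (C : ℕ → Matrix (CoinIdx d) (CoinIdx d) ℂ),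
      ∀ k ∉ F, prob r C φ₀ n k = 0 := by
  suffices h : ∃ F : Finset (Fin d → ℤ), ∀ (C : ℕ → Matrix (CoinIdx d) (CoinIdx d) ℂ),
      ∀ k ∉ F, evolution r C n (lp.single 2 (0 : Fin d → ℤ) φ₀) k = 0 by
    obtain ⟨F, hF⟩ := h
    exact ⟨F, fun C k hk => by simp [prob, hF C k hk]⟩
  classical
  induction n with
  | zero =>
    refine ⟨{0}, fun C k hk => ?_⟩
    have hk' : k ≠ 0 := by simpa using hk
    simp [evolution, hk']
  | succ n ih =>
    obtain ⟨F, hF⟩ := ih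
    refine ⟨Finset.univ.biUnion fun τ => F.image fun x => x + r τ, fun C k hk => ?_⟩
    ext τ
    have hk' : k - r τ ∉ F := fun hmem => hk (by
      simp only [Finset.mem_biUnion, Finset.mem_univ, true_and, Finset.mem_image]
      exact ⟨τ, _, hmem, by simp⟩)
    simp [evolution, shiftOp, coinOp, hF C _ hk']

/-- The averaged distribution `w_k(n) = 𝔼 (W_k^ω(n))`, for i.i.d. random coin matrices
`C(ω₁), C(ω₂), …`, the expectation being taken with respect to the product measure. -/
def avgProb {d : ℕ} {Ω : Type*} [MeasurableSpace Ω] (μ : Measure Ω) [IsProbabilityMeasure μ]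
    (r : CoinIdx d → Fin d → ℤ) (C : Ω → Matrix (CoinIdx d) (CoinIdx d) ℂ)
    (φ₀ : CoinSpace d) (n : ℕ) (k : Fin d → ℤ) : ℝ :=
  ∫ ω : ℕ → Ω, prob r (fun s => C (ω s)) φ₀ n k ∂(Measure.infinitePi fun _ : ℕ => μ)

/-- The averaged expectation `⟨f(X)⟩(n) = ∑ₖ f(k) w_k(n)`. -/
def avgExp {d : ℕ} {Ω : Type*} [MeasurableSpace Ω] (μ : Measure Ω) [IsProbabilityMeasure μ]
    (r : CoinIdx d → Fin d → ℤ) (C : Ω → Matrix (CoinIdx d) (CoinIdx d) ℂ)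
    (φ₀ : CoinSpace d) (n : ℕ) (f : (Fin d → ℤ) → ℝ) : ℝ :=
  ∑' k : Fin d → ℤ, f k * avgProb μ r C φ₀ n k

/-- The averaged characteristic function `Φ_n(y) = ∑ₖ w_k(n) e^{i y·k}`, for `y ∈ ℂ^d`. -/
def charFn {d : ℕ} {Ω : Type*} [MeasurableSpace Ω] (μ : Measure Ω) [IsProbabilityMeasure μ]
    (r : CoinIdx d → Fin d → ℤ) (C : Ω → Matrix (CoinIdx d) (CoinIdx d) ℂ)
    (φ₀ : CoinSpace d) (n : ℕ) (y : Fin d → ℂ) : ℂ :=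
  ∑' k : Fin d → ℤ,
    (avgProb μ r C φ₀ n k : ℂ) * Complex.exp (Complex.I * ∑ j, y j * (k j : ℂ))

/-- The averaged matrix `𝔼 (C ⊗ C̄)` on `ℂ^{2d} ⊗ ℂ^{2d}`. -/
def avgCoin {d : ℕ} {Ω : Type*} [MeasurableSpace Ω] (μ : Measure Ω)
    (C : Ω → Matrix (CoinIdx d) (CoinIdx d) ℂ) :
    Matrix (CoinIdx d × CoinIdx d) (CoinIdx d × CoinIdx d) ℂ :=
  Matrix.of fun S T => ∫ ω, (C ω ⊗ₖ (C ω).map star) S T ∂μ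

/-- The diagonal matrix `D(y, y')` with entries `e^{i (y·r(τ) + y'·r(τ'))}`. -/
def phase {d : ℕ} (r : CoinIdx d → Fin d → ℤ) (y y' : Fin d → ℝ) :
    Matrix (CoinIdx d × CoinIdx d) (CoinIdx d × CoinIdx d) ℂ :=
  Matrix.diagonal fun T => Complex.exp (Complex.I *
    ((∑ j, (y j * (r T.1 j : ℝ) + y' j * (r T.2 j : ℝ)) : ℝ) : ℂ))

/-- The averaged matrix `M(y, y') = D(y, y') 𝔼 (C ⊗ C̄)`. -/
def avgMatrix {d : ℕ} {Ω : Type*} [MeasurableSpace Ω] (μ : Measure Ω)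
    (r : CoinIdx d → Fin d → ℤ) (C : Ω → Matrix (CoinIdx d) (CoinIdx d) ℂ)
    (y y' : Fin d → ℝ) : Matrix (CoinIdx d × CoinIdx d) (CoinIdx d × CoinIdx d) ℂ :=
  phase r y y' * avgCoin μ C

/-- The torus `𝕋^d = [0, 2π)^d`. -/
def torus (d : ℕ) : Set (Fin d → ℝ) := Set.univ.pi fun _ => Set.Ico 0 (2 * Real.pi)

/-- The integral `∫_{𝕋^d} f(v) dṽ` for the normalised measure `dṽ = dv / (2π)^d`. -/
def torusInt {d : ℕ} (f : (Fin d → ℝ) → ℂ) : ℂ :=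
  (((2 * Real.pi) ^ d : ℝ) : ℂ)⁻¹ * ∫ v in torus d, f v

/-- Assumption S: for every `v ∈ 𝕋^d`, the number `1` is the only eigenvalue of `M(-v, v)` on the
unit circle, and it is a simple eigenvalue (of algebraic multiplicity one). -/
def AssumptionS {d : ℕ} {Ω : Type*} [MeasurableSpace Ω] (μ : Measure Ω)
    (r : CoinIdx d → Fin d → ℤ) (C : Ω → Matrix (CoinIdx d) (CoinIdx d) ℂ) : Prop :=
  ∀ v ∈ torus d,
    spectrum ℂ (avgMatrix μ r C (-v) v) ∩ Metric.sphere (0 : ℂ) 1 = {1} ∧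
    (avgMatrix μ r C (-v) v).charpoly.rootMultiplicity 1 = 1

/-- The mean `r̄ = (1 / 2d) ∑_τ r(τ)` of the jump function. -/
def meanJump {d : ℕ} (r : CoinIdx d → Fin d → ℤ) (j : Fin d) : ℝ :=
  (1 / (2 * d : ℝ)) * ∑ τ, (r τ j : ℝ)

/-- The projection `P = |Ψ₀⟩⟨Ψ₀|` with `Ψ₀ = (2d)^{-1/2} ∑_τ |τ ⊗ τ⟩`. -/
def projPsi (d : ℕ) : Matrix (CoinIdx d × CoinIdx d) (CoinIdx d × CoinIdx d) ℂ :=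
  Matrix.of fun S T => if S.1 = S.2 ∧ T.1 = T.2 then 1 / (2 * d : ℂ) else 0

/-- The reduced resolvent `S(z)` of a matrix `M` at its eigenvalue `1` with spectral projection
`P`, defined by `(M - z)⁻¹ = P / (1 - z) + S(z)` for `z` close to `1`, `z ≠ 1`, and by analytic
continuation at `z = 1`. In closed form `S(z) = (M - P - z)⁻¹ (1 - P)`; see
`resolvent_eq_add_reducedResolvent`. -/
def reducedResolvent {ι : Type*} [Fintype ι] [DecidableEq ι] (M P : Matrix ι ι ℂ) (z : ℂ) :
    Matrix ι ι ℂ :=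
  (M - P - z • (1 : Matrix ι ι ℂ))⁻¹ * (1 - P)

theorem resolvent_eq_add_reducedResolvent {ι : Type*} [Fintype ι] [DecidableEq ι]
    (M P : Matrix ι ι ℂ) (hP : P * P = P) (hMP : M * P = P) (hPM : P * M = P) (z : ℂ)
    (hz : z ≠ 1) (hu : IsUnit (M - P - z • (1 : Matrix ι ι ℂ)).det) :
    (M - z • (1 : Matrix ι ι ℂ))⁻¹ = (1 - z)⁻¹ • P + reducedResolvent M P z := by
  have hz' : (1 - z) ≠ 0 := sub_ne_zero.2 hz.symm
  set N := M - P - z • (1 : Matrix ι ι ℂ) with hN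
  have hcomm : P * N = N * P := by
    simp [hN, mul_sub, sub_mul, hP, hMP, hPM]
  have hcomm' : P * N⁻¹ = N⁻¹ * P := by
    calc P * N⁻¹ = N⁻¹ * N * P * N⁻¹ := by rw [Matrix.nonsing_inv_mul _ hu, one_mul]
      _ = N⁻¹ * (P * N) * N⁻¹ := by rw [hcomm, mul_assoc N⁻¹ N P]
      _ = N⁻¹ * P := by
        rw [← mul_assoc, mul_assoc _ N, Matrix.mul_nonsing_inv _ hu, mul_one]
  have hM : M - z • (1 : Matrix ι ι ℂ) = N + P := by rw [hN]; abel
  have hMP' : (M - z • (1 : Matrix ι ι ℂ)) * P = (1 - z) • P := by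
    rw [sub_mul, hMP, smul_mul_assoc, one_mul, sub_smul, one_smul]
  refine Matrix.inv_eq_right_inv ?_
  rw [mul_add, mul_smul_comm, hMP', smul_smul, inv_mul_cancel₀ hz', one_smul, reducedResolvent,
    ← hN, hM, add_mul, ← mul_assoc, ← mul_assoc, Matrix.mul_nonsing_inv _ hu, one_mul, hcomm',
    mul_assoc, mul_sub, mul_one, hP, sub_self, mul_zero, add_zero]
  abel

/-- The diffusion matrix
`𝔻(v) = |r̄⟩⟨r̄| - (1/2d) ∑_τ |r(τ)⟩⟨r(τ)|
  - (1/d) Sym (∑_{τ,τ'} |r(τ)⟩ ⟨τ ⊗ τ, S_v(1) τ' ⊗ τ'⟩ ⟨r(τ')|)`,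
where `Sym A = (A + Aᵀ) / 2` and `S_v` is the reduced resolvent of `M(-v, v)` at the eigenvalue `1`.
It is the symmetric matrix for which the eigenvalue of `M(y - v, v)` close to `1` is
`exp (i y·r̄ - ⟨y, 𝔻(v) y⟩ / 2 + O(‖y‖³))` as `y → 0`. -/
def diffusionMatrix {d : ℕ} {Ω : Type*} [MeasurableSpace Ω] (μ : Measure Ω)
    (r : CoinIdx d → Fin d → ℤ) (C : Ω → Matrix (CoinIdx d) (CoinIdx d) ℂ)
    (v : Fin d → ℝ) : Matrix (Fin d) (Fin d) ℂ :=
  Matrix.of fun i j =>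
    (meanJump r i : ℂ) * (meanJump r j : ℂ)
      - (1 / (2 * d : ℂ)) * ∑ τ, (r τ i : ℂ) * (r τ j : ℂ)
      - (1 / (d : ℂ)) * ∑ τ, ∑ τ', (((r τ i : ℂ) * (r τ' j : ℂ) + (r τ j : ℂ) * (r τ' i : ℂ)) / 2)
          * reducedResolvent (avgMatrix μ r C (-v) v) (projPsi d) 1 (τ, τ) (τ', τ')

/-- The bilinear form `⟨y, A y⟩ = ∑_{i,j} y_i A_{ij} y_j` on `ℂ^d` (no complex conjugation). -/
def quadForm {d : ℕ} (A : Matrix (Fin d) (Fin d) ℂ) (y : Fin d → ℂ) : ℂ := y ⬝ᵥ (A *ᵥ y)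

/-- The partial derivative `∂g/∂y_j`. -/
def partialDeriv {d : ℕ} (j : Fin d) (g : (Fin d → ℂ) → ℂ) : (Fin d → ℂ) → ℂ :=
  fun y => fderiv ℂ g y (Pi.single j 1)

/-- The mixed partial derivative `(∂/∂y_1)^{s_1} ⋯ (∂/∂y_d)^{s_d} g`. -/
def mixedDeriv {d : ℕ} (s : Fin d → ℕ) (g : (Fin d → ℂ) → ℂ) : (Fin d → ℂ) → ℂ :=
  (List.finRange d).foldr (fun j h => (partialDeriv j)^[s j] h) g

end

end RandomQW

/-!
In the relative and centre-of-mass momenta, averaging over the coins turns `|ψ_n⟩⟨ψ_n|` into the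
iteration of the matrices `M(y - v, v) = D(y, 0) M(-v, v)`, so that `Φ_n(y)` is the integral over
`v` in the torus of a matrix element of `(D(y, 0) M(-v, v)) ^ n` against `∑_τ |τ ⊗ τ⟩`. By
Assumption S and compactness of the torus, `M(-v, v) = P + Q(v)`, with `Q(v)` power-stable uniformly
in `v`.

Once the drift `exp (i y·r̄)` is factored out, the first order term of the perturbation has no
component along `P`, and second order perturbation theory gives a left vector `L` close to `P` which
is multiplied by `exp (-⟨y, 𝔻(v) y⟩ / 2)` up to an error `O(‖y‖³)`. Such errors are negligible over
`O(‖y‖⁻²)` steps, which covers both scalings.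

The functions of `y` in play are entire and converge locally uniformly, hence so do all their
derivatives; evaluated at `y = 0`, these are the moments.
-/

namespace RandomQW

open Asymptotics

section Ring

variable {A : Type*} [Ring A]

theorem mul_pow_sub_eq_mul_geom_sum (L B : A) (m : ℕ) :
    L * B ^ m - L = (L * B - L) * ∑ i ∈ Finset.range m, B ^ i := by
  have hL : L * B - L = L * (B - 1) := by rw [mul_sub, mul_one]
  rw [hL, mul_assoc, mul_geom_sum, mul_sub, mul_one]

theorem one_sub_mul_add_pow {P Q : A} (hP : P * P = P) (hPQ : P * Q = 0) (hQP : Q * P = 0)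
    {n : ℕ} (hn : n ≠ 0) : (1 - P) * (P + Q) ^ n = Q ^ n := by
  obtain ⟨k, rfl⟩ := Nat.exists_eq_succ_of_ne_zero hn
  induction k with
  | zero => simp [sub_mul, mul_add, hP, hPQ]
  | succ k ih =>
    rw [pow_succ, ← mul_assoc, ih k.succ_ne_zero, mul_add, ← pow_succ, pow_succ Q k, mul_assoc, hQP,
      mul_zero, zero_add]

end Ring

section PowerStability

variable {A : Type*} [NormedRing A]

theorem norm_mul_pow_sub_le {L B : A} {m : ℕ} {K : ℝ} (hK : ∀ i < m, ‖B ^ i‖ ≤ K) :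
    ‖L * B ^ m - L‖ ≤ m * ‖L * B - L‖ * K := by
  have hsum : ‖∑ i ∈ Finset.range m, B ^ i‖ ≤ m * K := by
    simpa using norm_sum_le_of_le _ fun i hi => hK i (Finset.mem_range.1 hi)
  calc ‖L * B ^ m - L‖ ≤ ‖L * B - L‖ * ‖∑ i ∈ Finset.range m, B ^ i‖ := by
        rw [mul_pow_sub_eq_mul_geom_sum]; exact norm_mul_le _ _
    _ ≤ ‖L * B - L‖ * (m * K) := by gcongr
    _ = m * ‖L * B - L‖ * K := by ring

/- The components `L * B ^ j` and `(1 - L) * B ^ j` are estimated simultaneously: the first one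
is almost constant in `j`, and the second one is contracted at each step. -/
theorem norm_pow_le_of_almost_invariant {L B : A} {S ρ : ℝ} (hL : ‖L‖ ≤ S) (hL' : ‖1 - L‖ ≤ S)
    (hLB : ‖L * B - L‖ ≤ ρ) (hB : ‖(1 - L) * B‖ ≤ 1 / 2) (j : ℕ) :
    ‖B ^ j‖ ≤ 2 * S * (1 + 2 * ρ) ^ j := by
  have hρ : 0 ≤ ρ := (norm_nonneg _).trans hLB
  have hS : 0 ≤ S := (norm_nonneg _).trans hL
  have hsplit (k : ℕ) : ‖B ^ k‖ ≤ ‖L * B ^ k‖ + ‖(1 - L) * B ^ k‖ := by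
    simpa [sub_mul] using norm_add_le (L * B ^ k) ((1 - L) * B ^ k)
  suffices h : ‖L * B ^ j‖ ≤ S * (1 + 2 * ρ) ^ j ∧ ‖(1 - L) * B ^ j‖ ≤ S * (1 + 2 * ρ) ^ j by
    linarith [hsplit j]
  induction j with
  | zero => simpa using And.intro hL hL'
  | succ j ih =>
    obtain ⟨ihL, ihL'⟩ := ih
    have hpow : ‖B ^ j‖ ≤ 2 * (S * (1 + 2 * ρ) ^ j) := by linarith [hsplit j]
    have hg : 0 ≤ S * (1 + 2 * ρ) ^ j := by positivity
    constructor
    · have hstep : L * B ^ (j + 1) = L * B ^ j + (L * B - L) * B ^ j := by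
        rw [pow_succ']; noncomm_ring
      calc ‖L * B ^ (j + 1)‖ ≤ ‖L * B ^ j‖ + ‖L * B - L‖ * ‖B ^ j‖ := by
            rw [hstep]; exact norm_add_le_of_le le_rfl (norm_mul_le _ _)
        _ ≤ S * (1 + 2 * ρ) ^ j + ρ * (2 * (S * (1 + 2 * ρ) ^ j)) := by gcongr
        _ = S * (1 + 2 * ρ) ^ (j + 1) := by ring
    · calc ‖(1 - L) * B ^ (j + 1)‖ ≤ ‖(1 - L) * B‖ * ‖B ^ j‖ := by
            rw [pow_succ', ← mul_assoc]; exact norm_mul_le _ _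
        _ ≤ 1 / 2 * (2 * (S * (1 + 2 * ρ) ^ j)) := by gcongr
        _ ≤ S * (1 + 2 * ρ) ^ (j + 1) := by
            rw [pow_succ]; nlinarith [mul_nonneg hg hρ]

variable {ι : Type*} {𝓕 : Filter ι}

theorem isBigO_one_pow {B : ι → A} (hB : B =O[𝓕] fun _ => (1 : ℝ)) (n : ℕ) :
    (fun x => B x ^ n) =O[𝓕] fun _ => (1 : ℝ) := by
  induction n with
  | zero => simpa using isBigO_const_const (1 : A) (one_ne_zero' ℝ) 𝓕
  | succ n ih => simpa only [pow_succ, mul_one] using ih.mul hB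

theorem tendsto_pow_sub_pow_zero {B C : ι → A} (hB : B =O[𝓕] fun _ => (1 : ℝ))
    (hC : C =O[𝓕] fun _ => (1 : ℝ)) (h : Tendsto (fun x => B x - C x) 𝓕 (𝓝 0)) (n : ℕ) :
    Tendsto (fun x => B x ^ n - C x ^ n) 𝓕 (𝓝 0) := by
  rw [← isLittleO_one_iff ℝ] at h ⊢
  induction n with
  | zero => simpa only [pow_zero, sub_self] using isLittleO_zero _ _
  | succ n ih =>
    have hstep : (fun x => B x ^ (n + 1) - C x ^ (n + 1))
        = fun x => (B x ^ n - C x ^ n) * B x + C x ^ n * (B x - C x) := by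
      ext x; rw [pow_succ, pow_succ]; noncomm_ring
    rw [hstep]
    simpa using (ih.mul_isBigO hB).add ((isBigO_one_pow hC n).mul_isLittleO h)

variable {P : A} {Q B L : ι → A} {m : ι → ℕ}

/-- A family `B` close to `P + Q`, where `P` is a projection and `Q` is annihilated by `P` and
uniformly stable, together with an approximate left eigenvector `L` of `B`, close to `P`. The
integer `N` is a number of steps after which `Q` is a contraction, and the defect of `L` is small
compared with `1 / m`. -/
structure AlmostInvariant (𝓕 : Filter ι) (P : A) (Q B L : ι → A) (m : ι → ℕ) (N : ℕ) : Prop where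
  proj_mul_proj : P * P = P
  proj_mul : ∀ x, P * Q x = 0
  mul_proj : ∀ x, Q x * P = 0
  isBigO : Q =O[𝓕] fun _ => (1 : ℝ)
  steps_ne_zero : N ≠ 0
  norm_pow_le : ∀ x, ‖Q x ^ N‖ ≤ 1 / 4
  tendsto_sub : Tendsto (fun x => B x - (P + Q x)) 𝓕 (𝓝 0)
  tendsto_left : Tendsto L 𝓕 (𝓝 P)
  tendsto_defect : Tendsto (fun x => (m x : ℝ) * ‖L x * B x - L x‖) 𝓕 (𝓝 0)

namespace AlmostInvariant

variable {N : ℕ}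

theorem isBigO_add (h : AlmostInvariant 𝓕 P Q B L m N) :
    (fun x => P + Q x) =O[𝓕] fun _ => (1 : ℝ) :=
  (isBigO_const_const P (one_ne_zero' ℝ) 𝓕).add h.isBigO

theorem isBigO_base (h : AlmostInvariant 𝓕 P Q B L m N) : B =O[𝓕] fun _ => (1 : ℝ) := by
  simpa using ((isLittleO_one_iff ℝ).2 h.tendsto_sub).isBigO.add h.isBigO_add

theorem tendsto_one_sub_mul_pow (h : AlmostInvariant 𝓕 P Q B L m N) :
    Tendsto (fun x => (1 - L x) * B x ^ N - Q x ^ N) 𝓕 (𝓝 0) := by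
  have hLP : Tendsto (fun x => P - L x) 𝓕 (𝓝 0) := by
    simpa using tendsto_const_nhds (x := P).sub h.tendsto_left
  have hpow := tendsto_pow_sub_pow_zero h.isBigO_base h.isBigO_add h.tendsto_sub N
  have heq : (fun x => (1 - L x) * B x ^ N - Q x ^ N)
      = fun x => (P - L x) * B x ^ N + (1 - P) * (B x ^ N - (P + Q x) ^ N) := by
    ext x
    rw [mul_sub, one_sub_mul_add_pow h.proj_mul_proj (h.proj_mul x) (h.mul_proj x) h.steps_ne_zero]
    noncomm_ring
  rw [← isLittleO_one_iff ℝ] at hLP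
  rw [heq, ← isLittleO_one_iff ℝ]
  refine IsLittleO.add (by simpa using hLP.mul_isBigO (isBigO_one_pow h.isBigO_base N)) ?_
  rw [isLittleO_one_iff]
  simpa using hpow.const_mul (1 - P)

theorem tendsto_defect_pow (h : AlmostInvariant 𝓕 P Q B L m N) :
    Tendsto (fun x => (m x : ℝ) * ‖L x * B x ^ N - L x‖) 𝓕 (𝓝 0) := by
  have hsum : (fun x => ∑ i ∈ Finset.range N, B x ^ i) =O[𝓕] fun _ => (1 : ℝ) :=
    IsBigO.fun_sum fun i _ => isBigO_one_pow h.isBigO_base i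
  have hprod := ((isLittleO_one_iff ℝ).2 h.tendsto_defect).mul_isBigO hsum.norm_left
  simp only [mul_one, isLittleO_one_iff] at hprod
  refine squeeze_zero (fun x => by positivity) (fun x => ?_) hprod
  rw [mul_pow_sub_eq_mul_geom_sum, mul_assoc]
  gcongr
  exact norm_mul_le _ _

theorem exists_norm_pow_mul_le (h : AlmostInvariant 𝓕 P Q B L m N) :
    ∃ K, ∀ᶠ x in 𝓕, ∀ j ≤ m x, ‖(B x ^ N) ^ j‖ ≤ K := by
  set S := max ‖P‖ ‖1 - P‖ + 1
  have hL : ∀ᶠ x in 𝓕, ‖L x‖ ≤ S :=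
    h.tendsto_left.norm.eventually_le_const (lt_add_of_le_of_pos (le_max_left _ _) one_pos)
  have hL' : ∀ᶠ x in 𝓕, ‖1 - L x‖ ≤ S :=
    (tendsto_const_nhds.sub h.tendsto_left).norm.eventually_le_const
      (lt_add_of_le_of_pos (le_max_right _ _) one_pos)
  have hB : ∀ᶠ x in 𝓕, ‖(1 - L x) * B x ^ N - Q x ^ N‖ ≤ 1 / 4 :=
    h.tendsto_one_sub_mul_pow.norm.eventually_le_const (by norm_num)
  refine ⟨2 * S * Real.exp 2, ?_⟩
  filter_upwards [hL, hL', hB, h.tendsto_defect_pow.eventually_le_const one_pos]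
    with x hL hL' hB hdefect j hj
  have hcontr : ‖(1 - L x) * B x ^ N‖ ≤ 1 / 2 := by
    linarith [norm_le_norm_sub_add ((1 - L x) * B x ^ N) (Q x ^ N), h.norm_pow_le x]
  refine (norm_pow_le_of_almost_invariant hL hL' le_rfl hcontr j).trans ?_
  have : 0 ≤ S := (norm_nonneg _).trans hL
  set ρ := ‖L x * B x ^ N - L x‖
  gcongr
  calc (1 + 2 * ρ) ^ j ≤ Real.exp (2 * ρ) ^ j := by
        gcongr; linarith [Real.add_one_le_exp (2 * ρ)]
    _ = Real.exp (2 * (j * ρ)) := by rw [← Real.exp_nat_mul]; ring_nf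
    _ ≤ Real.exp 2 := by
        have : (j : ℝ) * ρ ≤ m x * ρ := by gcongr
        exact Real.exp_le_exp.2 (by linarith)

theorem exists_norm_pow_le (h : AlmostInvariant 𝓕 P Q B L m N) :
    ∃ K, ∀ᶠ x in 𝓕, ∀ j ≤ m x, ‖B x ^ j‖ ≤ K := by
  obtain ⟨K, hK⟩ := h.exists_norm_pow_mul_le
  have hrem : (fun x => ∑ i ∈ Finset.range N, ‖B x ^ i‖) =O[𝓕] fun _ => (1 : ℝ) :=
    IsBigO.fun_sum fun i _ => (isBigO_one_pow h.isBigO_base i).norm_left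
  obtain ⟨K', hK'⟩ := hrem.bound
  refine ⟨K * K', ?_⟩
  filter_upwards [hK, hK'] with x hK hK' j hj
  rw [norm_one, mul_one, Real.norm_of_nonneg (by positivity)] at hK'
  have hmod : ‖B x ^ (j % N)‖ ≤ K' :=
    (Finset.single_le_sum (f := fun i => ‖B x ^ i‖) (fun _ _ => norm_nonneg _)
      (Finset.mem_range.2 (Nat.mod_lt j (Nat.pos_of_ne_zero h.steps_ne_zero)))).trans hK'
  have hdiv : ‖(B x ^ N) ^ (j / N)‖ ≤ K := hK _ ((Nat.div_le_self j N).trans hj)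
  rw [← Nat.div_add_mod j N, pow_add, pow_mul]
  exact (norm_mul_le _ _).trans
    (mul_le_mul hdiv hmod (norm_nonneg _) ((norm_nonneg _).trans hdiv))

theorem tendsto_mul_pow (h : AlmostInvariant 𝓕 P Q B L m N) :
    Tendsto (fun x => P * B x ^ m x) 𝓕 (𝓝 P) := by
  obtain ⟨K, hK⟩ := h.exists_norm_pow_le
  have hdefect : Tendsto (fun x => L x * B x ^ m x - L x) 𝓕 (𝓝 0) := by
    refine squeeze_zero_norm' ?_ (by simpa using h.tendsto_defect.mul_const K)
    filter_upwards [hK] with x hK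
    exact norm_mul_pow_sub_le fun i hi => hK i hi.le
  have hbound : (fun x => B x ^ m x) =O[𝓕] fun _ => (1 : ℝ) :=
    IsBigO.of_bound K (by filter_upwards [hK] with x hK using by simpa using hK _ le_rfl)
  have hLP : Tendsto (fun x => L x - P) 𝓕 (𝓝 0) := by
    simpa using h.tendsto_left.sub_const P
  have herror : Tendsto (fun x => (L x - P) * B x ^ m x) 𝓕 (𝓝 0) := by
    rw [← isLittleO_one_iff ℝ] at hLP ⊢
    simpa using hLP.mul_isBigO hbound
  have heq : (fun x => P * B x ^ m x)
      = fun x => (L x * B x ^ m x - L x) - (L x - P) * B x ^ m x + L x := by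
    ext x; noncomm_ring
  rw [heq]
  simpa using (hdefect.sub herror).add h.tendsto_left

end AlmostInvariant

end PowerStability

section ApproxEigenvector

variable {A : Type*} [Ring A]

/-- The correction `Z` to the left eigenvector `P` of `P + Q` when `P + Q` is multiplied on the
left by `1 + W + V + O(ε³)`, with `W = O(ε)` and `V = O(ε²)`. Here `H` is an element with
`H * (P + Q) = H - Q`, for instance `P - 1` minus the reduced resolvent of `P + Q` at `1`. -/
def leftCorrection (P H W V : A) : A := P * (W + W * H * W + V)

/-- The left eigenvector of `(1 + W + V + O(ε³)) * (P + Q)`, up to errors of order `ε³`. -/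
def approxEigenvector (P H W V : A) : A := P + leftCorrection P H W V * H

theorem approxEigenvector_mul_eq {P Q H : A} (W V D : A) (hP : P * P = P) (hPQ : P * Q = 0)
    (hH : H * (P + Q) = H - Q) :
    approxEigenvector P H W V * (D * (P + Q)) - approxEigenvector P H W V =
      leftCorrection P H W V * P +
        (P * (W * H * W + V) * H * W + leftCorrection P H W V * H * V +
          approxEigenvector P H W V * (D - (1 + W + V))) * (P + Q) := by
  have hinv : approxEigenvector P H W V * (P + Q)
      = approxEigenvector P H W V - leftCorrection P H W V * Q := by
    rw [approxEigenvector, add_mul, mul_assoc, hH, mul_add, hP, hPQ, mul_sub]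
    abel
  have hexpand : approxEigenvector P H W V * (W + V) = leftCorrection P H W V +
      (P * (W * H * W + V) * H * W + leftCorrection P H W V * H * V) := by
    simp only [approxEigenvector, leftCorrection]
    noncomm_ring
  calc approxEigenvector P H W V * (D * (P + Q)) - approxEigenvector P H W V
      = approxEigenvector P H W V * (P + Q) - approxEigenvector P H W V
        + (approxEigenvector P H W V * (W + V)
          + approxEigenvector P H W V * (D - (1 + W + V))) * (P + Q) := by noncomm_ring
    _ = _ := by rw [hinv, hexpand]; noncomm_ring

end ApproxEigenvector

section Perturbation

variable {A : Type*} [NormedRing A]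

variable {ι : Type*} {𝓕 : Filter ι} {ε : ι → ℝ} {P : A} {Q H W V D : ι → A}

theorem isBigO_leftCorrection (hε : Tendsto ε 𝓕 (𝓝 0)) (hH : H =O[𝓕] fun _ => (1 : ℝ))
    (hW : W =O[𝓕] ε) (hV : V =O[𝓕] fun x => ε x ^ 2) :
    (fun x => leftCorrection P (H x) (W x) (V x)) =O[𝓕] ε := by
  have hε2 : (fun x => ε x ^ 2) =O[𝓕] ε := by
    simpa [sq] using ((isLittleO_one_iff ℝ).2 hε).isBigO.mul (isBigO_refl ε 𝓕)
  have hP : (fun _ : ι => P) =O[𝓕] fun _ => (1 : ℝ) := isBigO_const_const P (one_ne_zero' ℝ) 𝓕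
  have hWHW : (fun x => W x * H x * W x) =O[𝓕] fun x => ε x ^ 2 :=
    ((hW.mul hH).mul hW).congr_right fun x => by ring
  simpa only [leftCorrection, one_mul] using
    hP.mul ((hW.add (hWHW.trans hε2)).add (hV.trans hε2))

theorem tendsto_approxEigenvector (hε : Tendsto ε 𝓕 (𝓝 0)) (hH : H =O[𝓕] fun _ => (1 : ℝ))
    (hW : W =O[𝓕] ε) (hV : V =O[𝓕] fun x => ε x ^ 2) :
    Tendsto (fun x => approxEigenvector P (H x) (W x) (V x)) 𝓕 (𝓝 P) := by
  have h : (fun x => leftCorrection P (H x) (W x) (V x) * H x) =O[𝓕] ε := by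
    simpa using (isBigO_leftCorrection (P := P) hε hH hW hV).mul hH
  simpa [approxEigenvector] using (h.trans_tendsto hε).const_add P

theorem isBigO_approxEigenvector_mul_sub (hε : Tendsto ε 𝓕 (𝓝 0)) (hP : P * P = P)
    (hPQ : ∀ x, P * Q x = 0) (hHM : ∀ x, H x * (P + Q x) = H x - Q x)
    (hQ : Q =O[𝓕] fun _ => (1 : ℝ)) (hH : H =O[𝓕] fun _ => (1 : ℝ)) (hW : W =O[𝓕] ε)
    (hV : V =O[𝓕] fun x => ε x ^ 2)
    (hD : (fun x => D x - (1 + W x + V x)) =O[𝓕] fun x => ε x ^ 3) :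
    (fun x => approxEigenvector P (H x) (W x) (V x) * (D x * (P + Q x))
      - approxEigenvector P (H x) (W x) (V x) - leftCorrection P (H x) (W x) (V x) * P)
      =O[𝓕] fun x => ε x ^ 3 := by
  have hP1 : (fun _ : ι => P) =O[𝓕] fun _ => (1 : ℝ) := isBigO_const_const P (one_ne_zero' ℝ) 𝓕
  have hZ := isBigO_leftCorrection (P := P) hε hH hW hV
  have hL : (fun x => approxEigenvector P (H x) (W x) (V x)) =O[𝓕] fun _ => (1 : ℝ) :=
    (tendsto_approxEigenvector hε hH hW hV).isBigO_one ℝ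
  have hWHW : (fun x => W x * H x * W x) =O[𝓕] fun x => ε x ^ 2 :=
    ((hW.mul hH).mul hW).congr_right fun x => by ring
  have hfst : (fun x => P * (W x * H x * W x + V x) * H x * W x) =O[𝓕] fun x => ε x ^ 3 :=
    (((hP1.mul (hWHW.add hV)).mul hH).mul hW).congr_right fun x => by ring
  have hsnd : (fun x => leftCorrection P (H x) (W x) (V x) * H x * V x)
      =O[𝓕] fun x => ε x ^ 3 := ((hZ.mul hH).mul hV).congr_right fun x => by ring
  have hthd : (fun x => approxEigenvector P (H x) (W x) (V x) * (D x - (1 + W x + V x)))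
      =O[𝓕] fun x => ε x ^ 3 := by simpa using hL.mul hD
  refine (((hfst.add hsnd).add hthd).mul (hP1.add hQ)).congr (fun x => ?_) fun x => mul_one _
  rw [approxEigenvector_mul_eq _ _ _ hP (hPQ x) (hHM x), add_sub_cancel_left]

theorem isBigO_exp_neg_sub_one_add {c : ι → ℂ} (hε : Tendsto ε 𝓕 (𝓝 0))
    (hc : c =O[𝓕] fun x => ε x ^ 2) :
    (fun x => Complex.exp (-c x) - 1 + c x) =O[𝓕] fun x => ε x ^ 4 := by
  have hc0 : Tendsto (fun x => -c x) 𝓕 (𝓝 0) :=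
    hc.neg_left.trans_tendsto (by simpa using hε.pow 2)
  have hsq : (fun x => (-c x) ^ 2) =O[𝓕] fun x => ε x ^ 4 :=
    (hc.neg_left.pow 2).congr_right fun x => by ring
  refine (((Complex.exp_sub_sum_range_isBigO_pow 2).comp_tendsto hc0).trans hsq).congr_left ?_
  intro x
  simp only [Function.comp_apply, Finset.sum_range_succ, Finset.sum_range_zero]
  norm_num
  ring

theorem isBigO_exp_neg_smul_sub [NormedAlgebra ℂ A] {L Y : ι → A} {c : ι → ℂ}
    (hε : Tendsto ε 𝓕 (𝓝 0)) (hc : c =O[𝓕] fun x => ε x ^ 2)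
    (hL : (fun x => L x - P) =O[𝓕] ε)
    (hY : (fun x => Y x - L x - c x • P) =O[𝓕] fun x => ε x ^ 3) :
    (fun x => Complex.exp (-c x) • Y x - L x) =O[𝓕] fun x => ε x ^ 3 := by
  have hε1 : ε =O[𝓕] fun _ => (1 : ℝ) := ((isLittleO_one_iff ℝ).2 hε).isBigO
  have hε3 : (fun x => ε x ^ 4) =O[𝓕] fun x => ε x ^ 3 :=
    ((isBigO_refl (fun x => ε x ^ 3) 𝓕).mul hε1).congr (fun x => by ring) fun x => by ring
  have hP : (fun _ : ι => P) =O[𝓕] fun _ => (1 : ℝ) := isBigO_const_const P (one_ne_zero' ℝ) 𝓕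
  have hc1 : c =O[𝓕] fun _ => (1 : ℝ) := by simpa using hc.trans (hε1.pow 2)
  have hL1 : L =O[𝓕] fun _ => (1 : ℝ) := by simpa using (hL.trans hε1).add hP
  have hexp := (isBigO_exp_neg_sub_one_add hε hc).trans hε3
  have hexp1 : (fun x => Complex.exp (-c x)) =O[𝓕] fun _ => (1 : ℝ) := by
    simpa [sub_add] using ((hexp.trans (by simpa using hε1.pow 3)).add
      (isBigO_const_const (1 : ℂ) (one_ne_zero' ℝ) 𝓕)).sub hc1
  have herror : (fun x => Complex.exp (-c x) • (Y x - L x - c x • P)) =O[𝓕] fun x => ε x ^ 3 := by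
    simpa using hexp1.smul hY
  have hquartic : (fun x => (Complex.exp (-c x) - 1 + c x) • (L x + c x • P))
      =O[𝓕] fun x => ε x ^ 3 := by
    simpa using hexp.smul (hL1.add (by simpa using hc1.smul hP))
  have hcubic : (fun x => c x • (L x - P)) =O[𝓕] fun x => ε x ^ 3 := by
    simpa [← pow_succ] using hc.smul hL
  have hsquare : (fun x => c x ^ 2 • P) =O[𝓕] fun x => ε x ^ 3 := by
    refine IsBigO.trans ?_ hε3
    simpa [← pow_mul] using (hc.pow 2).smul hP
  refine (((herror.add hquartic).sub hcubic).sub hsquare).congr_left fun x => ?_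
  module

theorem tendsto_exp_neg_smul_mul_sub [NormedAlgebra ℂ A] {M : ι → A} {c : ι → ℂ}
    (hc : Tendsto c 𝓕 (𝓝 0)) (hM : M =O[𝓕] fun _ => (1 : ℝ)) (hD : Tendsto D 𝓕 (𝓝 1)) :
    Tendsto (fun x => Complex.exp (-c x) • (D x * M x) - M x) 𝓕 (𝓝 0) := by
  have hexp : Tendsto (fun x => Complex.exp (-c x)) 𝓕 (𝓝 1) := by
    simpa [Function.comp_def] using (Complex.continuous_exp.tendsto _).comp hc.neg
  have hfactor : Tendsto (fun x => Complex.exp (-c x) • D x - 1) 𝓕 (𝓝 0) := by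
    simpa using (hexp.smul hD).sub_const 1
  rw [← isLittleO_one_iff ℝ] at hfactor ⊢
  simpa [sub_mul] using hfactor.mul_isBigO hM

theorem tendsto_of_isBigO_sub_one_add_add (hε : Tendsto ε 𝓕 (𝓝 0)) (hW : W =O[𝓕] ε)
    (hV : V =O[𝓕] fun x => ε x ^ 2)
    (hD : (fun x => D x - (1 + W x + V x)) =O[𝓕] fun x => ε x ^ 3) : Tendsto D 𝓕 (𝓝 1) := by
  have h := ((hD.trans_tendsto (by simpa using hε.pow 3)).add (hW.trans_tendsto hε)).add
    (hV.trans_tendsto (by simpa using hε.pow 2))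
  simpa using (h.add_const 1).congr fun x => by abel

/- Second order perturbation theory for the left eigenvector, with no appeal to the eigenvalue of
the perturbed element: an approximate eigenvector with error `O(ε³)` is good enough for powers of
order `ε⁻²`. -/
theorem tendsto_mul_exp_neg_smul_pow [NormedAlgebra ℂ A] {c : ι → ℂ} {m : ι → ℕ} {N : ℕ}
    (hε : Tendsto ε 𝓕 (𝓝 0)) (hmε : (fun x => (m x : ℝ) * ε x ^ 2) =O[𝓕] fun _ => (1 : ℝ))
    (hP : P * P = P) (hPQ : ∀ x, P * Q x = 0) (hQP : ∀ x, Q x * P = 0)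
    (hQ : Q =O[𝓕] fun _ => (1 : ℝ)) (hN : N ≠ 0) (hQN : ∀ x, ‖Q x ^ N‖ ≤ 1 / 4)
    (hH : H =O[𝓕] fun _ => (1 : ℝ)) (hHM : ∀ x, H x * (P + Q x) = H x - Q x)
    (hW : W =O[𝓕] ε) (hV : V =O[𝓕] fun x => ε x ^ 2)
    (hD : (fun x => D x - (1 + W x + V x)) =O[𝓕] fun x => ε x ^ 3)
    (hPWP : ∀ x, P * W x * P = 0) (hc : c =O[𝓕] fun x => ε x ^ 2)
    (hPVP : ∀ x, P * (W x * H x * W x + V x) * P = c x • P) :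
    Tendsto (fun x => P * (Complex.exp (-c x) • (D x * (P + Q x))) ^ m x) 𝓕 (𝓝 P) := by
  have hM : (fun x => P + Q x) =O[𝓕] fun _ => (1 : ℝ) :=
    (isBigO_const_const P (one_ne_zero' ℝ) 𝓕).add hQ
  set L := fun x => approxEigenvector P (H x) (W x) (V x) with hLdef
  have hLP : (fun x => L x - P) =O[𝓕] ε := by
    simpa [hLdef, approxEigenvector] using (isBigO_leftCorrection (P := P) hε hH hW hV).mul hH
  have hcorrection (x : ι) : leftCorrection P (H x) (W x) (V x) * P = c x • P := by
    rw [← hPVP, leftCorrection, add_assoc, mul_add, add_mul, hPWP, zero_add]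
  have hdefect : (fun x => L x * (Complex.exp (-c x) • (D x * (P + Q x))) - L x)
      =O[𝓕] fun x => ε x ^ 3 := by
    simp only [mul_smul_comm]
    refine isBigO_exp_neg_smul_sub hε hc hLP ?_
    simpa only [hcorrection] using
      isBigO_approxEigenvector_mul_sub hε hP hPQ hHM hQ hH hW hV hD
  refine AlmostInvariant.tendsto_mul_pow (Q := Q) (L := L) (N := N)
    ⟨hP, hPQ, hQP, hQ, hN, hQN, ?_, tendsto_approxEigenvector hε hH hW hV, ?_⟩
  · exact tendsto_exp_neg_smul_mul_sub (hc.trans_tendsto (by simpa using hε.pow 2)) hM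
      (tendsto_of_isBigO_sub_one_add_add hε hW hV hD)
  · refine IsBigO.trans_tendsto ?_ hε
    refine ((isBigO_refl (fun x => (m x : ℝ)) 𝓕).mul hdefect.norm_left).trans ?_
    exact (hmε.mul (isBigO_refl ε 𝓕)).congr (fun x => by ring) fun x => one_mul _

end Perturbation

section SpectralGap

theorem tendsto_pow_zero_of_spectrum_norm_lt_one {A : Type*} [NormedRing A] [NormedAlgebra ℂ A]
    [CompleteSpace A] [Nontrivial A] {a : A} (ha : ∀ z ∈ spectrum ℂ a, ‖z‖ < 1) :
    Tendsto (fun n : ℕ => a ^ n) atTop (𝓝 0) := by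
  have hradius : spectralRadius ℂ a < ((1 : NNReal) : ENNReal) :=
    spectrum.spectralRadius_lt_of_forall_lt a ha
  obtain ⟨s, hs, hs1⟩ := ENNReal.lt_iff_exists_nnreal_btwn.1 hradius
  have hroot := (spectrum.pow_nnnorm_pow_one_div_tendsto_nhds_spectralRadius a).eventually_lt_const
    hs
  refine squeeze_zero_norm' ?_ (tendsto_pow_atTop_nhds_zero_of_lt_one s.2 (by exact_mod_cast hs1))
  filter_upwards [hroot, eventually_gt_atTop 0] with n hn hn0
  have hn0' : (0 : ℝ) < n := by exact_mod_cast hn0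
  have hpow : (‖a ^ n‖₊ : ENNReal) < (s : ENNReal) ^ n := by
    have := ENNReal.rpow_lt_rpow hn hn0'
    rwa [← ENNReal.rpow_mul, one_div, inv_mul_cancel₀ hn0'.ne', ENNReal.rpow_one,
      ENNReal.rpow_natCast] at this
  exact_mod_cast hpow.le

theorem exists_forall_norm_pow_le {X A : Type*} [TopologicalSpace X] [NormedRing A] {s : Set X}
    (hs : IsCompact s) {Q : X → A} (hcont : ContinuousOn Q s) (hnorm : ∀ x ∈ s, ‖Q x‖ ≤ 1)
    (hlim : ∀ x ∈ s, Tendsto (fun n : ℕ => Q x ^ n) atTop (𝓝 0)) {δ : ℝ} (hδ : 0 < δ) :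
    ∃ N : ℕ, N ≠ 0 ∧ ∀ x ∈ s, ‖Q x ^ N‖ ≤ δ := by
  have hanti : ∀ x ∈ s, Antitone fun n : ℕ => ‖Q x ^ n‖ := fun x hx =>
    antitone_nat_of_succ_le fun n => by
      rw [pow_succ]
      exact (norm_mul_le_of_le le_rfl (hnorm x hx)).trans_eq (mul_one _)
  have hunif : TendstoUniformlyOn (fun (n : ℕ) x => ‖Q x ^ n‖) (fun _ => 0) atTop s :=
    Antitone.tendstoUniformlyOn_of_forall_tendsto hs (fun n => (hcont.pow n).norm) hanti
      continuousOn_const fun x hx => by simpa using (hlim x hx).norm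
  obtain ⟨N, hN, hN0⟩ :=
    ((Metric.tendstoUniformlyOn_iff.1 hunif δ hδ).and (eventually_ne_atTop 0)).exists
  exact ⟨N, hN0, fun x hx => by simpa using (hN x hx).le⟩

variable {K n : Type*} [Field K] [Fintype n] [DecidableEq n] {M P : Matrix n n K}

theorem mem_spectrum_iff_exists_mulVec {l : K} :
    l ∈ spectrum K M ↔ ∃ x ≠ 0, M *ᵥ x = l • x := by
  rw [← Matrix.spectrum_toLin', ← Module.End.hasEigenvalue_iff_mem_spectrum]
  constructor
  · intro h
    obtain ⟨x, hx⟩ := h.exists_hasEigenvector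
    exact ⟨x, hx.2, by simpa using hx.apply_eq_smul⟩
  · rintro ⟨x, hx0, hx⟩
    exact Module.End.hasEigenvalue_of_hasEigenvector
      ⟨Module.End.mem_eigenspace_iff.2 (by simpa using hx), hx0⟩

theorem eq_zero_of_mulVec_eq_self (hP : P * P = P) (hMP : M * P = P) (hP0 : P ≠ 0)
    (hsimple : M.charpoly.rootMultiplicity 1 ≤ 1) {x : n → K} (hx : M *ᵥ x = x)
    (hPx : P *ᵥ x = 0) : x = 0 := by
  have hfinrank : Module.finrank K (Module.End.eigenspace (Matrix.toLin' M) 1) ≤ 1 := by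
    refine (LinearMap.finrank_eigenspace_le _ _).trans ?_
    rwa [Matrix.charpoly_toLin']
  have hmem {y : n → K} (hy : M *ᵥ y = y) : y ∈ Module.End.eigenspace (Matrix.toLin' M) 1 :=
    Module.End.mem_eigenspace_iff.2 (by simpa using hy)
  obtain ⟨w, hw⟩ := finrank_le_one_iff.1 hfinrank
  obtain ⟨b, hb⟩ := hw ⟨x, hmem hx⟩
  have hbx : b • (w : n → K) = x := congrArg Subtype.val hb
  by_contra hx0
  have hb0 : b ≠ 0 := by rintro rfl; exact hx0 (by rw [← hbx, zero_smul])
  have hPw : P *ᵥ (w : n → K) = 0 := by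
    rw [← hbx, Matrix.mulVec_smul] at hPx
    exact (smul_eq_zero.1 hPx).resolve_left hb0
  refine hP0 (Matrix.ext_of_mulVec_single fun i => ?_)
  obtain ⟨a, ha⟩ := hw ⟨P *ᵥ Pi.single i 1, hmem (by rw [Matrix.mulVec_mulVec, hMP])⟩
  have haw : a • (w : n → K) = P *ᵥ Pi.single i 1 := congrArg Subtype.val ha
  rw [Matrix.zero_mulVec, ← hP, ← Matrix.mulVec_mulVec, ← haw, Matrix.mulVec_smul, hPw, smul_zero]

theorem mem_spectrum_and_ne_one_of_mem_spectrum_sub (hP : P * P = P) (hMP : M * P = P)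
    (hPM : P * M = P) (hP0 : P ≠ 0) (hsimple : M.charpoly.rootMultiplicity 1 ≤ 1) {l : K}
    (hl0 : l ≠ 0) (hl : l ∈ spectrum K (M - P)) : l ∈ spectrum K M ∧ l ≠ 1 := by
  obtain ⟨x, hx0, hx⟩ := mem_spectrum_iff_exists_mulVec.1 hl
  have hPx : P *ᵥ x = 0 := by
    have h : P *ᵥ ((M - P) *ᵥ x) = 0 := by
      rw [Matrix.mulVec_mulVec, mul_sub, hPM, hP, sub_self, Matrix.zero_mulVec]
    rw [hx, Matrix.mulVec_smul] at h
    exact (smul_eq_zero.1 h).resolve_left hl0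
  have hMx : M *ᵥ x = l • x := by rw [← hx, Matrix.sub_mulVec, hPx, sub_zero]
  refine ⟨mem_spectrum_iff_exists_mulVec.2 ⟨x, hx0, hMx⟩, ?_⟩
  rintro rfl
  exact hx0 (eq_zero_of_mulVec_eq_self hP hMP hP0 hsimple (by rw [hMx, one_smul]) hPx)

end SpectralGap

section DiagVec

variable {ι : Type*} [DecidableEq ι]

/-- The (unnormalised) vector `∑_τ |τ ⊗ τ⟩`. -/
def diagVec (ι : Type*) [DecidableEq ι] : ι × ι → ℂ := fun T => if T.1 = T.2 then 1 else 0

@[simp]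
theorem diagVec_apply_self (τ : ι) : diagVec ι (τ, τ) = 1 := if_pos rfl

theorem diagVec_apply_of_ne {T : ι × ι} (hT : T.1 ≠ T.2) : diagVec ι T = 0 := if_neg hT

variable [Fintype ι]

theorem dotProduct_diagVec (w : ι × ι → ℂ) : w ⬝ᵥ diagVec ι = ∑ τ, w (τ, τ) := by
  simp [dotProduct, diagVec, Fintype.sum_prod_type]

theorem diagVec_dotProduct (w : ι × ι → ℂ) : diagVec ι ⬝ᵥ w = ∑ τ, w (τ, τ) := by
  rw [dotProduct_comm, dotProduct_diagVec]

theorem diagVec_dotProduct_self : diagVec ι ⬝ᵥ diagVec ι = Fintype.card ι := by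
  simp [diagVec_dotProduct]

theorem diagonal_mulVec_diagVec {w : ι × ι → ℂ} (hw : ∀ τ, w (τ, τ) = 1) :
    Matrix.diagonal w *ᵥ diagVec ι = diagVec ι := by
  ext T
  rw [Matrix.mulVec_diagonal]
  by_cases hT : T.1 = T.2
  · rw [show T = (T.1, T.1) from Prod.ext rfl hT.symm, hw, one_mul]
  · rw [diagVec_apply_of_ne hT, mul_zero]

theorem diagVec_vecMul_diagonal {w : ι × ι → ℂ} (hw : ∀ τ, w (τ, τ) = 1) :
    diagVec ι ᵥ* Matrix.diagonal w = diagVec ι := by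
  rw [← Matrix.mulVec_transpose, Matrix.diagonal_transpose, diagonal_mulVec_diagVec hw]

theorem diagVec_dotProduct_diagonal_mul_mul_diagonal (a b : ι × ι → ℂ)
    (X : Matrix (ι × ι) (ι × ι) ℂ) :
    diagVec ι ⬝ᵥ (Matrix.diagonal a * X * Matrix.diagonal b) *ᵥ diagVec ι
      = ∑ τ, ∑ τ', a (τ, τ) * X (τ, τ) (τ', τ') * b (τ', τ') := by
  simp only [diagVec_dotProduct, Matrix.mulVec, dotProduct_diagVec, Matrix.mul_diagonal,
    Matrix.diagonal_mul]

theorem diagVec_dotProduct_diagonal_mul_smul_one_add_mul_diagonal (a : ι → ℂ) (c : ℂ)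
    (R : Matrix (ι × ι) (ι × ι) ℂ) :
    diagVec ι ⬝ᵥ (Matrix.diagonal (fun T => a T.1) * (c • 1 + R)
        * Matrix.diagonal (fun T => a T.1)) *ᵥ diagVec ι
      = c * ∑ τ, a τ ^ 2 + ∑ τ, ∑ τ', a τ * R (τ, τ) (τ', τ') * a τ' := by
  have hscalar (τ τ' : ι) : a τ * (c • (1 : Matrix (ι × ι) (ι × ι) ℂ)) (τ, τ) (τ', τ') * a τ'
      = if τ = τ' then c * a τ ^ 2 else 0 := by
    by_cases h : τ = τ'
    · subst h; simp; ring
    · simp [h]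
  rw [diagVec_dotProduct_diagonal_mul_mul_diagonal]
  simp only [Matrix.add_apply, mul_add, add_mul, hscalar, Finset.sum_add_distrib,
    Finset.sum_ite_eq, Finset.mem_univ, if_true, Finset.mul_sum]

end DiagVec

section Projection

variable {d : ℕ}

theorem card_coinIdx : Fintype.card (CoinIdx d) = 2 * d := by simp [CoinIdx, mul_comm]

theorem projPsi_eq_smul_vecMulVec :
    projPsi d
      = (1 / (2 * d) : ℂ) • Matrix.vecMulVec (diagVec (CoinIdx d)) (diagVec (CoinIdx d)) := by
  ext S T
  by_cases hS : S.1 = S.2 <;> by_cases hT : T.1 = T.2 <;>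
    simp [projPsi, diagVec, Matrix.vecMulVec_apply, hS, hT]

theorem projPsi_mul_mul_projPsi (X : Matrix (CoinIdx d × CoinIdx d) (CoinIdx d × CoinIdx d) ℂ) :
    projPsi d * X * projPsi d
      = (1 / (2 * d) * (diagVec (CoinIdx d) ⬝ᵥ X *ᵥ diagVec (CoinIdx d)) : ℂ) • projPsi d := by
  simp only [projPsi_eq_smul_vecMulVec, smul_mul_assoc, mul_smul_comm, Matrix.vecMulVec_mul,
    Matrix.vecMul_vecMulVec, Matrix.vecMulVec_smul, Matrix.dotProduct_mulVec, smul_smul]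
  congr 1
  ring

theorem mul_projPsi_eq_self {X : Matrix (CoinIdx d × CoinIdx d) (CoinIdx d × CoinIdx d) ℂ}
    (hX : X *ᵥ diagVec (CoinIdx d) = diagVec (CoinIdx d)) : X * projPsi d = projPsi d := by
  rw [projPsi_eq_smul_vecMulVec, mul_smul_comm, Matrix.mul_vecMulVec, hX]

theorem projPsi_mul_eq_self {X : Matrix (CoinIdx d × CoinIdx d) (CoinIdx d × CoinIdx d) ℂ}
    (hX : diagVec (CoinIdx d) ᵥ* X = diagVec (CoinIdx d)) : projPsi d * X = projPsi d := by
  rw [projPsi_eq_smul_vecMulVec, smul_mul_assoc, Matrix.vecMulVec_mul, hX]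

theorem projPsi_mulVec_diagVec [NeZero d] :
    projPsi d *ᵥ diagVec (CoinIdx d) = diagVec (CoinIdx d) := by
  have hd : (d : ℂ) ≠ 0 := Nat.cast_ne_zero.2 (NeZero.ne d)
  rw [projPsi_eq_smul_vecMulVec, Matrix.smul_mulVec, Matrix.vecMulVec_mulVec,
    diagVec_dotProduct_self, card_coinIdx]
  ext T
  simp
  field_simp

theorem diagVec_vecMul_projPsi [NeZero d] :
    diagVec (CoinIdx d) ᵥ* projPsi d = diagVec (CoinIdx d) := by
  rw [← Matrix.mulVec_transpose, projPsi_eq_smul_vecMulVec, Matrix.transpose_smul,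
    Matrix.transpose_vecMulVec, ← projPsi_eq_smul_vecMulVec, projPsi_mulVec_diagVec]

theorem isStarProjection_projPsi [NeZero d] : IsStarProjection (projPsi d) where
  isIdempotentElem := mul_projPsi_eq_self projPsi_mulVec_diagVec
  isSelfAdjoint := by
    ext S T
    simp [projPsi, Matrix.star_apply, and_comm, apply_ite (starRingEnd ℂ), map_ofNat]

theorem projPsi_mul_self [NeZero d] : projPsi d * projPsi d = projPsi d :=
  isStarProjection_projPsi.isIdempotentElem

theorem projPsi_ne_zero [NeZero d] : projPsi d ≠ 0 := fun h => by
  have hδ := projPsi_mulVec_diagVec (d := d)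
  rw [h, Matrix.zero_mulVec] at hδ
  simpa using congrFun hδ ((0, 1), (0, 1))

end Projection

section AveragedCoin

variable {d : ℕ} {Ω : Type*} [MeasurableSpace Ω]

/-- A random unitary coin matrix: unitary everywhere, with measurable entries. -/
structure IsRandomUnitary (C : Ω → Matrix (CoinIdx d) (CoinIdx d) ℂ) : Prop where
  mem_unitaryGroup : ∀ ω, C ω ∈ Matrix.unitaryGroup (CoinIdx d) ℂ
  measurable_apply : ∀ σ τ, Measurable fun ω => C ω σ τ

variable {μ : Measure Ω} {C : Ω → Matrix (CoinIdx d) (CoinIdx d) ℂ}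

theorem avgCoin_apply (S T : CoinIdx d × CoinIdx d) :
    avgCoin μ C S T = ∫ ω, C ω S.1 T.1 * star (C ω S.2 T.2) ∂μ := by
  simp [avgCoin, Matrix.kroneckerMap_apply]

namespace IsRandomUnitary

theorem measurable_mul_star (hC : IsRandomUnitary C) (σ τ σ' τ' : CoinIdx d) :
    Measurable fun ω => C ω σ τ * star (C ω σ' τ') :=
  (hC.measurable_apply σ τ).mul (continuous_star.measurable.comp (hC.measurable_apply σ' τ'))

theorem norm_apply_le (hC : IsRandomUnitary C) (ω : Ω) (σ τ : CoinIdx d) : ‖C ω σ τ‖ ≤ 1 :=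
  entry_norm_bound_of_unitary (hC.mem_unitaryGroup ω) σ τ

theorem integrable_mul_star [IsFiniteMeasure μ] (hC : IsRandomUnitary C) (σ τ σ' τ' : CoinIdx d) :
    Integrable (fun ω => C ω σ τ * star (C ω σ' τ')) μ := by
  refine Integrable.of_bound (C := 1) (hC.measurable_mul_star σ τ σ' τ').aestronglyMeasurable
    (ae_of_all _ fun ω => ?_)
  rw [norm_mul, norm_star]
  exact mul_le_one₀ (hC.norm_apply_le ω σ τ) (norm_nonneg _) (hC.norm_apply_le ω σ' τ')

variable [IsProbabilityMeasure μ]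

theorem avgCoin_mulVec_diagVec (hC : IsRandomUnitary C) :
    avgCoin μ C *ᵥ diagVec (CoinIdx d) = diagVec (CoinIdx d) := by
  ext S
  have hrow (ω : Ω) : ∑ τ, C ω S.1 τ * star (C ω S.2 τ) = diagVec (CoinIdx d) S := by
    have h := congrFun₂ (Matrix.mem_unitaryGroup_iff.1 (hC.mem_unitaryGroup ω)) S.1 S.2
    simpa [Matrix.mul_apply, Matrix.star_apply, Matrix.one_apply, diagVec] using h
  rw [Matrix.mulVec, dotProduct_diagVec]
  simp only [avgCoin_apply]
  rw [← integral_finsetSum _ fun τ _ => hC.integrable_mul_star _ _ _ _]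
  simp only [hrow, integral_const, probReal_univ, one_smul]

theorem diagVec_vecMul_avgCoin (hC : IsRandomUnitary C) :
    diagVec (CoinIdx d) ᵥ* avgCoin μ C = diagVec (CoinIdx d) := by
  ext T
  have hcol (ω : Ω) : ∑ τ, C ω τ T.1 * star (C ω τ T.2) = diagVec (CoinIdx d) T := by
    have h := congrFun₂ (Matrix.mem_unitaryGroup_iff'.1 (hC.mem_unitaryGroup ω)) T.2 T.1
    simpa [Matrix.mul_apply, Matrix.star_apply, Matrix.one_apply, diagVec, mul_comm, eq_comm]
      using h
  rw [Matrix.vecMul, diagVec_dotProduct]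
  simp only [avgCoin_apply]
  rw [← integral_finsetSum _ fun τ _ => hC.integrable_mul_star _ _ _ _]
  simp only [hcol, integral_const, probReal_univ, one_smul]

end IsRandomUnitary

end AveragedCoin

section OperatorNorm

open scoped Matrix.Norms.L2Operator

theorem norm_of_integral_le {Ω n : Type*} [MeasurableSpace Ω] {μ : Measure Ω}
    [IsProbabilityMeasure μ] [Fintype n] [DecidableEq n] {U : Ω → Matrix n n ℂ} {K : ℝ}
    (hU : ∀ ω, ‖U ω‖ ≤ K) (hm : ∀ i j, Measurable fun ω => U ω i j) :
    ‖Matrix.of fun i j => ∫ ω, U ω i j ∂μ‖ ≤ K := by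
  have hsm : StronglyMeasurable U :=
    (measurable_pi_iff.2 fun i => measurable_pi_iff.2 fun j => hm i j :
      Measurable fun ω i j => U ω i j).stronglyMeasurable
  have hint : Integrable U μ := Integrable.of_bound hsm.aestronglyMeasurable K (ae_of_all _ hU)
  have hentry : Matrix.of (fun i j => ∫ ω, U ω i j ∂μ) = ∫ ω, U ω ∂μ := by
    ext i j
    exact (LinearMap.toContinuousLinearMap
      (Matrix.entryLinearMap ℂ ℂ i j)).integral_comp_comm hint
  rw [hentry]
  simpa using norm_integral_le_of_norm_le_const (μ := μ) (ae_of_all _ hU)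

end OperatorNorm

section AveragedMatrix

variable {d : ℕ} {Ω : Type*} [MeasurableSpace Ω] {μ : Measure Ω} {r : CoinIdx d → Fin d → ℤ}
  {C : Ω → Matrix (CoinIdx d) (CoinIdx d) ℂ}

/-- The part `M(-v, v) - P` of the averaged matrix away from the eigenvalue `1`. -/
noncomputable def restMatrix (μ : Measure Ω) (r : CoinIdx d → Fin d → ℤ)
    (C : Ω → Matrix (CoinIdx d) (CoinIdx d) ℂ) (v : Fin d → ℝ) :
    Matrix (CoinIdx d × CoinIdx d) (CoinIdx d × CoinIdx d) ℂ :=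
  avgMatrix μ r C (-v) v - projPsi d

theorem projPsi_add_restMatrix (v : Fin d → ℝ) :
    projPsi d + restMatrix μ r C v = avgMatrix μ r C (-v) v :=
  add_sub_cancel _ _

theorem continuous_avgMatrix_neg_self : Continuous fun v => avgMatrix μ r C (-v) v := by
  unfold avgMatrix phase
  refine Continuous.matrix_mul (Continuous.matrix_diagonal (continuous_pi fun T => ?_))
    continuous_const
  simp only [Pi.neg_apply]
  fun_prop

theorem torus_subset_Icc : torus d ⊆ Set.Icc (0 : Fin d → ℝ) fun _ => 2 * Real.pi :=
  fun _ hv => ⟨fun j => (hv j trivial).1, fun j => (hv j trivial).2.le⟩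

theorem exists_mem_torus_avgMatrix_eq (μ : Measure Ω) (r : CoinIdx d → Fin d → ℤ)
    (C : Ω → Matrix (CoinIdx d) (CoinIdx d) ℂ) (v : Fin d → ℝ) :
    ∃ w ∈ torus d, avgMatrix μ r C (-w) w = avgMatrix μ r C (-v) v := by
  refine ⟨fun j => toIcoMod Real.two_pi_pos 0 (v j), fun j _ => by
    simpa using toIcoMod_mem_Ico Real.two_pi_pos 0 (v j), ?_⟩
  unfold avgMatrix phase
  congr 2
  ext T
  rw [Complex.exp_eq_exp_iff_exists_int]
  refine ⟨∑ j, toIcoDiv Real.two_pi_pos 0 (v j) * (r T.1 j - r T.2 j), ?_⟩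
  simp only [Pi.neg_apply, toIcoMod, zsmul_eq_mul]
  push_cast
  rw [Finset.sum_mul, Finset.mul_sum, Finset.mul_sum, ← Finset.sum_add_distrib]
  exact Finset.sum_congr rfl fun j _ => by ring

section

open scoped Matrix.Norms.L2Operator

theorem norm_phase_le_one (y y' : Fin d → ℝ) : ‖phase r y y'‖ ≤ 1 := by
  rw [phase, Matrix.l2_opNorm_diagonal, pi_norm_le_iff_of_nonneg zero_le_one]
  intro T
  rw [mul_comm, Complex.norm_exp_ofReal_mul_I]

end

namespace IsRandomUnitary

variable [IsProbabilityMeasure μ] (hC : IsRandomUnitary C)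
include hC

theorem avgMatrix_mul_projPsi (v : Fin d → ℝ) :
    avgMatrix μ r C (-v) v * projPsi d = projPsi d := by
  refine mul_projPsi_eq_self ?_
  rw [avgMatrix, ← Matrix.mulVec_mulVec, hC.avgCoin_mulVec_diagVec, phase]
  exact diagonal_mulVec_diagVec fun τ => by simp

theorem projPsi_mul_avgMatrix (v : Fin d → ℝ) :
    projPsi d * avgMatrix μ r C (-v) v = projPsi d := by
  refine projPsi_mul_eq_self ?_
  rw [avgMatrix, ← Matrix.vecMul_vecMul, phase, diagVec_vecMul_diagonal fun τ => by simp,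
    hC.diagVec_vecMul_avgCoin]

theorem restMatrix_mul_projPsi [NeZero d] (v : Fin d → ℝ) :
    restMatrix μ r C v * projPsi d = 0 := by
  rw [restMatrix, sub_mul, hC.avgMatrix_mul_projPsi, projPsi_mul_self, sub_self]

theorem projPsi_mul_restMatrix [NeZero d] (v : Fin d → ℝ) :
    projPsi d * restMatrix μ r C v = 0 := by
  rw [restMatrix, mul_sub, hC.projPsi_mul_avgMatrix, projPsi_mul_self, sub_self]

open scoped Matrix.Norms.L2Operator

theorem norm_avgCoin_le_one [NeZero d] : ‖avgCoin μ C‖ ≤ 1 := by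
  refine norm_of_integral_le (U := fun ω => C ω ⊗ₖ (C ω).map star) (fun ω => ?_)
    fun S T => hC.measurable_mul_star S.1 T.1 S.2 T.2
  have hU := hC.mem_unitaryGroup ω
  exact (CStarRing.norm_of_mem_unitary
    (Matrix.kronecker_mem_unitary hU (Matrix.map_star_mem_unitaryGroup_iff.2 hU))).le

theorem norm_avgMatrix_le_one [NeZero d] (y y' : Fin d → ℝ) : ‖avgMatrix μ r C y y'‖ ≤ 1 :=
  (norm_mul_le_of_le (norm_phase_le_one y y') hC.norm_avgCoin_le_one).trans_eq (one_mul 1)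

theorem norm_restMatrix_le_one [NeZero d] (v : Fin d → ℝ) : ‖restMatrix μ r C v‖ ≤ 1 := by
  have h : restMatrix μ r C v = avgMatrix μ r C (-v) v * (1 - projPsi d) := by
    rw [mul_sub, mul_one, hC.avgMatrix_mul_projPsi, restMatrix]
  rw [h]
  exact (norm_mul_le_of_le (hC.norm_avgMatrix_le_one _ _)
    (IsStarProjection.norm_le _ isStarProjection_projPsi.one_sub)).trans_eq (one_mul 1)

theorem norm_lt_one_of_mem_spectrum_restMatrix [NeZero d] (hS : AssumptionS μ r C)
    (v : Fin d → ℝ) {l : ℂ} (hl : l ∈ spectrum ℂ (restMatrix μ r C v)) : ‖l‖ < 1 := by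
  by_contra! hl1
  obtain ⟨w, hw, hwv⟩ := exists_mem_torus_avgMatrix_eq μ r C v
  obtain ⟨hsphere, hsimple⟩ := hS w hw
  rw [hwv] at hsphere hsimple
  obtain ⟨hlM, hne⟩ := mem_spectrum_and_ne_one_of_mem_spectrum_sub projPsi_mul_self
    (hC.avgMatrix_mul_projPsi v) (hC.projPsi_mul_avgMatrix v) projPsi_ne_zero hsimple.le
    (norm_pos_iff.1 (one_pos.trans_le hl1)) hl
  have hle : ‖l‖ ≤ 1 :=
    (spectrum.norm_le_norm_of_mem hlM).trans (hC.norm_avgMatrix_le_one _ _)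
  exact hne (hsphere.subset ⟨hlM, by simp [le_antisymm hle hl1]⟩)

theorem exists_forall_norm_restMatrix_pow_le [NeZero d] (hS : AssumptionS μ r C) {δ : ℝ}
    (hδ : 0 < δ) : ∃ N : ℕ, N ≠ 0 ∧ ∀ v, ‖restMatrix μ r C v ^ N‖ ≤ δ := by
  have : CompleteSpace (Matrix (CoinIdx d × CoinIdx d) (CoinIdx d × CoinIdx d) ℂ) :=
    FiniteDimensional.complete ℂ _
  obtain ⟨N, hN0, hN⟩ := exists_forall_norm_pow_le (Q := restMatrix μ r C)
    (isCompact_Icc (a := (0 : Fin d → ℝ)) (b := fun _ => 2 * Real.pi))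
    (continuous_avgMatrix_neg_self.sub continuous_const).continuousOn
    (fun v _ => hC.norm_restMatrix_le_one v)
    (fun v _ => tendsto_pow_zero_of_spectrum_norm_lt_one fun _ =>
      hC.norm_lt_one_of_mem_spectrum_restMatrix hS v) hδ
  refine ⟨N, hN0, fun v => ?_⟩
  obtain ⟨w, hw, hwv⟩ := exists_mem_torus_avgMatrix_eq μ r C v
  rw [restMatrix, ← hwv]
  exact hN w (torus_subset_Icc hw)

theorem isUnit_restMatrix_sub_one [NeZero d] (hS : AssumptionS μ r C) (v : Fin d → ℝ) :
    IsUnit (restMatrix μ r C v - 1) := by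
  have h : (1 : ℂ) ∉ spectrum ℂ (restMatrix μ r C v) := fun h =>
    (hC.norm_lt_one_of_mem_spectrum_restMatrix hS v h).ne norm_one
  rw [spectrum.notMem_iff, map_one] at h
  rwa [← neg_sub, IsUnit.neg_iff]

end IsRandomUnitary

end AveragedMatrix

section QuadForm

variable {d : ℕ}

theorem quadForm_vecMulVec (a b z : Fin d → ℂ) :
    quadForm (Matrix.vecMulVec a b) z = (z ⬝ᵥ a) * (z ⬝ᵥ b) := by
  rw [quadForm, Matrix.dotProduct_mulVec, Matrix.vecMul_vecMulVec, smul_dotProduct, smul_eq_mul,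
    dotProduct_comm b]

theorem quadForm_smul (A : Matrix (Fin d) (Fin d) ℂ) (c : ℂ) (z : Fin d → ℂ) :
    quadForm A (c • z) = c ^ 2 * quadForm A z := by
  simp only [quadForm, Matrix.mulVec_smul, smul_dotProduct, dotProduct_smul, smul_eq_mul]
  ring

theorem norm_quadForm_le (A : Matrix (Fin d) (Fin d) ℂ) (z : Fin d → ℂ) :
    ‖quadForm A z‖ ≤ (∑ i, ∑ j, ‖A i j‖) * ‖z‖ ^ 2 := by
  simp only [quadForm, dotProduct, Matrix.mulVec, Finset.mul_sum, Finset.sum_mul]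
  refine norm_sum_le_of_le _ fun i _ => norm_sum_le_of_le _ fun j _ => ?_
  calc ‖z i * (A i j * z j)‖ = ‖A i j‖ * (‖z i‖ * ‖z j‖) := by rw [norm_mul, norm_mul]; ring
    _ ≤ ‖A i j‖ * (‖z‖ * ‖z‖) := by gcongr <;> exact norm_le_pi_norm _ _
    _ = ‖A i j‖ * ‖z‖ ^ 2 := by rw [sq]

end QuadForm

section CenteredJump

variable {d : ℕ} (r : CoinIdx d → Fin d → ℤ)

/-- The jump `r(τ)` with its mean `r̄` subtracted. -/
noncomputable def centeredJump (τ : CoinIdx d) : Fin d → ℂ := fun j => r τ j - meanJump r j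

theorem sum_centeredJump : ∑ τ, centeredJump r τ = 0 := by
  ext j
  have hd : (d : ℂ) ≠ 0 := Nat.cast_ne_zero.2 (by rintro rfl; exact j.elim0)
  simp only [centeredJump, Finset.sum_apply, Finset.sum_sub_distrib, Finset.sum_const,
    Finset.card_univ, card_coinIdx, meanJump, Pi.zero_apply, nsmul_eq_mul]
  push_cast
  field_simp
  rw [sub_self, mul_zero]

theorem dotProduct_centeredJump (z : Fin d → ℂ) (τ : CoinIdx d) :
    z ⬝ᵥ centeredJump r τ = (z ⬝ᵥ fun j => (r τ j : ℂ)) - z ⬝ᵥ fun j => (meanJump r j : ℂ) :=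
  dotProduct_sub _ _ _

theorem sum_dotProduct_centeredJump (z : Fin d → ℂ) : ∑ τ, z ⬝ᵥ centeredJump r τ = 0 := by
  rw [← dotProduct_sum, sum_centeredJump, dotProduct_zero]

/-- The diagonal matrix with entries `i z·(r(τ) - r̄)` on `τ ⊗ τ'`. -/
noncomputable def centeredDiag (z : Fin d → ℂ) :
    Matrix (CoinIdx d × CoinIdx d) (CoinIdx d × CoinIdx d) ℂ :=
  Matrix.diagonal fun T => Complex.I * (z ⬝ᵥ centeredJump r T.1)

theorem projPsi_mul_centeredDiag_mul_projPsi (z : Fin d → ℂ) :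
    projPsi d * centeredDiag r z * projPsi d = 0 := by
  have h : diagVec (CoinIdx d) ⬝ᵥ centeredDiag r z *ᵥ diagVec (CoinIdx d) = 0 := by
    simp only [diagVec_dotProduct, centeredDiag, Matrix.mulVec_diagonal, diagVec_apply_self,
      mul_one, ← Finset.mul_sum, sum_dotProduct_centeredJump, mul_zero]
  rw [projPsi_mul_mul_projPsi, h, mul_zero, zero_smul]

end CenteredJump

section ReducedResolvent

variable {n : Type*} [Fintype n] [DecidableEq n] {M P : Matrix n n ℂ}

theorem reducedResolvent_mul_eq_zero (hP : P * P = P) (z : ℂ) :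
    reducedResolvent M P z * P = 0 := by
  rw [reducedResolvent, mul_assoc, sub_mul, one_mul, hP, sub_self, mul_zero]

theorem mul_reducedResolvent_one_eq_zero (hP : P * P = P) (hPM : P * M = P)
    (hu : IsUnit (M - P - 1)) : P * reducedResolvent M P 1 = 0 := by
  have hinv : P * (M - P - 1)⁻¹ = -P := by
    rw [← hu.mul_left_inj, mul_assoc,
      Matrix.nonsing_inv_mul _ ((Matrix.isUnit_iff_isUnit_det _).1 hu)]
    simp only [neg_mul, mul_sub, mul_one, hPM, hP]
    abel
  rw [reducedResolvent, one_smul, ← mul_assoc, hinv, mul_sub, mul_one, neg_mul, hP, sub_self]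

/-- The matrix `H = P - 1 - S(1)`, where `S` is the reduced resolvent. It solves the equation
`H M = H - (M - P)` that determines the first order perturbation of the left eigenvectors. -/
noncomputable def corrector (M P : Matrix n n ℂ) : Matrix n n ℂ := P - 1 - reducedResolvent M P 1

theorem corrector_mul (hP : P * P = P) (hMP : M * P = P) (hPM : P * M = P)
    (hu : IsUnit (M - P - 1)) : corrector M P * M = corrector M P - (M - P) := by
  have hcomm : (1 - P) * (M - P - 1) = (M - P - 1) * (1 - P) := by
    simp only [mul_sub, sub_mul, one_mul, mul_one, hP, hMP, hPM]
    abel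
  have hR : reducedResolvent M P 1 * (M - P - 1) = 1 - P := by
    rw [reducedResolvent, one_smul, mul_assoc, hcomm, ← mul_assoc,
      Matrix.nonsing_inv_mul _ ((Matrix.isUnit_iff_isUnit_det _).1 hu), one_mul]
  rw [mul_sub, mul_sub, reducedResolvent_mul_eq_zero hP, sub_zero, mul_one] at hR
  have hRM : reducedResolvent M P 1 * M = reducedResolvent M P 1 + (1 - P) := by
    rw [← hR]; abel
  rw [corrector, sub_mul, sub_mul, one_mul, hPM, hRM]
  abel

end ReducedResolvent

section Diffusion

variable {d : ℕ} {Ω : Type*} [MeasurableSpace Ω] {μ : Measure Ω} {r : CoinIdx d → Fin d → ℤ}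
  {C : Ω → Matrix (CoinIdx d) (CoinIdx d) ℂ}

theorem diffusionMatrix_apply_comm (v : Fin d → ℝ) (i j : Fin d) :
    diffusionMatrix μ r C v i j = diffusionMatrix μ r C v j i := by
  simp only [diffusionMatrix, Matrix.of_apply, mul_comm, add_comm]

theorem diffusionMatrix_eq_sum_vecMulVec (v : Fin d → ℝ) :
    diffusionMatrix μ r C v
      = Matrix.vecMulVec (fun j => (meanJump r j : ℂ)) (fun j => (meanJump r j : ℂ))
        - (1 / (2 * d) : ℂ) • ∑ τ, Matrix.vecMulVec (fun j => (r τ j : ℂ)) (fun j => (r τ j : ℂ))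
        - (1 / (2 * d) : ℂ) • ∑ τ, ∑ τ',
            reducedResolvent (avgMatrix μ r C (-v) v) (projPsi d) 1 (τ, τ) (τ', τ') •
              (Matrix.vecMulVec (fun j => (r τ j : ℂ)) (fun j => (r τ' j : ℂ))
                + Matrix.vecMulVec (fun j => (r τ' j : ℂ)) (fun j => (r τ j : ℂ))) := by
  ext i j
  simp only [diffusionMatrix, Matrix.of_apply, Matrix.sub_apply, Matrix.smul_apply,
    Matrix.sum_apply, Matrix.add_apply, Matrix.vecMulVec_apply, smul_eq_mul]
  congr 1
  simp only [Finset.mul_sum]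
  refine Finset.sum_congr rfl fun τ _ => Finset.sum_congr rfl fun τ' _ => ?_
  ring

theorem quadForm_diffusionMatrix (v : Fin d → ℝ) (z : Fin d → ℂ) :
    quadForm (diffusionMatrix μ r C v) z
      = (z ⬝ᵥ fun j => (meanJump r j : ℂ)) ^ 2
        - (1 / (2 * d) : ℂ) * ∑ τ, (z ⬝ᵥ fun j => (r τ j : ℂ)) ^ 2
        - (1 / d : ℂ) * ∑ τ, ∑ τ', (z ⬝ᵥ fun j => (r τ j : ℂ))
            * reducedResolvent (avgMatrix μ r C (-v) v) (projPsi d) 1 (τ, τ) (τ', τ')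
            * (z ⬝ᵥ fun j => (r τ' j : ℂ)) := by
  let Q : Matrix (Fin d) (Fin d) ℂ →ₗ[ℂ] ℂ :=
    { toFun := fun A => quadForm A z
      map_add' := fun A B => by simp [quadForm, Matrix.add_mulVec]
      map_smul' := fun c A => by simp [quadForm, Matrix.smul_mulVec] }
  have hQ (a b : Fin d → ℂ) : Q (Matrix.vecMulVec a b) = (z ⬝ᵥ a) * (z ⬝ᵥ b) :=
    quadForm_vecMulVec a b z
  change Q _ = _
  simp only [diffusionMatrix_eq_sum_vecMulVec, map_sub, map_smul, map_sum, map_add, hQ,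
    smul_eq_mul, ← sq]
  congr 1
  simp only [Finset.mul_sum]
  refine Finset.sum_congr rfl fun τ _ => Finset.sum_congr rfl fun τ' _ => ?_
  ring

theorem sum_sum_sub_mul_mul_sub {ι : Type*} [Fintype ι] [DecidableEq ι]
    {R : Matrix (ι × ι) (ι × ι) ℂ} (hR : R *ᵥ diagVec ι = 0) (hR' : diagVec ι ᵥ* R = 0)
    (x : ι → ℂ) (c : ℂ) :
    ∑ τ, ∑ τ', (x τ - c) * R (τ, τ) (τ', τ') * (x τ' - c)
      = ∑ τ, ∑ τ', x τ * R (τ, τ) (τ', τ') * x τ' := by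
  have hrow (τ : ι) : ∑ τ', R (τ, τ) (τ', τ') = 0 := by
    simpa [Matrix.mulVec, dotProduct_diagVec] using congrFun hR (τ, τ)
  have hcol (τ' : ι) : ∑ τ, R (τ, τ) (τ', τ') = 0 := by
    simpa [Matrix.vecMul, diagVec_dotProduct] using congrFun hR' (τ', τ')
  have hright (τ : ι) : ∑ τ', (x τ - c) * R (τ, τ) (τ', τ') * (x τ' - c)
      = ∑ τ', (x τ - c) * R (τ, τ) (τ', τ') * x τ' := by
    simp only [mul_sub _ _ c, Finset.sum_sub_distrib, ← Finset.sum_mul, ← Finset.mul_sum, hrow,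
      mul_zero, zero_mul, sub_zero]
  simp only [hright]
  rw [Finset.sum_comm, Finset.sum_comm (f := fun τ τ' => x τ * _ * _)]
  refine Finset.sum_congr rfl fun τ' _ => ?_
  simp only [sub_mul, Finset.sum_sub_distrib, ← Finset.sum_mul, ← Finset.mul_sum, hcol,
    mul_zero, zero_mul, sub_zero]

namespace IsRandomUnitary

variable [IsProbabilityMeasure μ] [NeZero d] (hC : IsRandomUnitary C) (hS : AssumptionS μ r C)
include hC hS

theorem quadForm_diffusionMatrix_eq_centered (v : Fin d → ℝ) (z : Fin d → ℂ) :
    quadForm (diffusionMatrix μ r C v) z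
      = -((1 / (2 * d) : ℂ) * ∑ τ, (z ⬝ᵥ centeredJump r τ) ^ 2)
        - (1 / d : ℂ) * ∑ τ, ∑ τ', (z ⬝ᵥ centeredJump r τ)
            * reducedResolvent (avgMatrix μ r C (-v) v) (projPsi d) 1 (τ, τ) (τ', τ')
            * (z ⬝ᵥ centeredJump r τ') := by
  set R := reducedResolvent (avgMatrix μ r C (-v) v) (projPsi d) 1
  set m := z ⬝ᵥ fun j => (meanJump r j : ℂ)
  have hd : (d : ℂ) ≠ 0 := Nat.cast_ne_zero.2 (NeZero.ne d)
  have hR : R *ᵥ diagVec (CoinIdx d) = 0 := by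
    rw [← projPsi_mulVec_diagVec, Matrix.mulVec_mulVec,
      reducedResolvent_mul_eq_zero projPsi_mul_self, Matrix.zero_mulVec]
  have hR' : diagVec (CoinIdx d) ᵥ* R = 0 := by
    rw [← diagVec_vecMul_projPsi, Matrix.vecMul_vecMul, mul_reducedResolvent_one_eq_zero
      projPsi_mul_self (hC.projPsi_mul_avgMatrix v) (hC.isUnit_restMatrix_sub_one hS v),
      Matrix.vecMul_zero]
  have hsq : ∑ τ, (z ⬝ᵥ centeredJump r τ) ^ 2
      = ∑ τ, (z ⬝ᵥ fun j => (r τ j : ℂ)) ^ 2 - 2 * d * m ^ 2 := by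
    have hsum := sum_dotProduct_centeredJump r z
    simp only [dotProduct_centeredJump, Finset.sum_sub_distrib, Finset.sum_const,
      Finset.card_univ, card_coinIdx, nsmul_eq_mul, Nat.cast_mul, Nat.cast_ofNat] at hsum ⊢
    simp only [sub_sq, Finset.sum_add_distrib, Finset.sum_sub_distrib, ← Finset.sum_mul,
      ← Finset.mul_sum, sub_eq_zero.1 hsum, Finset.sum_const, Finset.card_univ, card_coinIdx,
      nsmul_eq_mul, Nat.cast_mul, Nat.cast_ofNat]
    ring
  rw [hsq, quadForm_diffusionMatrix]
  simp only [dotProduct_centeredJump]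
  rw [sum_sum_sub_mul_mul_sub hR hR']
  field_simp
  ring

theorem projPsi_mul_second_order_mul_projPsi (v : Fin d → ℝ) (z : Fin d → ℂ) :
    projPsi d * (centeredDiag r z * corrector (avgMatrix μ r C (-v) v) (projPsi d)
        * centeredDiag r z + (1 / 2 : ℂ) • (centeredDiag r z * centeredDiag r z)) * projPsi d
      = (-(1 / 2) * quadForm (diffusionMatrix μ r C v) z) • projPsi d := by
  set P := projPsi d
  set W := centeredDiag r z
  set R := reducedResolvent (avgMatrix μ r C (-v) v) P 1
  have hPWP : P * W * P = 0 := projPsi_mul_centeredDiag_mul_projPsi r z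
  have hd : (d : ℂ) ≠ 0 := Nat.cast_ne_zero.2 (NeZero.ne d)
  calc P * (W * (P - 1 - R) * W + (1 / 2 : ℂ) • (W * W)) * P
      = P * W * P * (W * P) - P * (W * ((1 / 2 : ℂ) • 1 + R) * W) * P := by
        simp only [mul_add, add_mul, mul_sub, sub_mul, mul_assoc, one_mul, smul_mul_assoc,
          mul_smul_comm]
        module
    _ = -(P * (W * ((1 / 2 : ℂ) • 1 + R) * W) * P) := by rw [hPWP, zero_mul, zero_sub]
    _ = _ := by
      rw [projPsi_mul_mul_projPsi, ← neg_smul]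
      congr 1
      simp only [W, centeredDiag]
      rw [diagVec_dotProduct_diagonal_mul_smul_one_add_mul_diagonal
          fun τ => Complex.I * (z ⬝ᵥ centeredJump r τ),
        hC.quadForm_diffusionMatrix_eq_centered hS]
      have hI (τ τ' : CoinIdx d) : Complex.I * (z ⬝ᵥ centeredJump r τ) * R (τ, τ) (τ', τ')
          * (Complex.I * (z ⬝ᵥ centeredJump r τ'))
          = -((z ⬝ᵥ centeredJump r τ) * R (τ, τ) (τ', τ') * (z ⬝ᵥ centeredJump r τ')) := by
        linear_combination (z ⬝ᵥ centeredJump r τ) * R (τ, τ) (τ', τ')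
          * (z ⬝ᵥ centeredJump r τ') * Complex.I_mul_I
      simp only [hI, mul_pow, Complex.I_sq, neg_one_mul, Finset.sum_neg_distrib]
      field_simp
      ring

end IsRandomUnitary

end Diffusion

section Continuity

theorem exists_forall_mem_torus_norm_le {d : ℕ} {E : Type*} [SeminormedAddCommGroup E]
    {f : (Fin d → ℝ) → E} (hf : Continuous f) : ∃ K, ∀ v ∈ torus d, ‖f v‖ ≤ K := by
  obtain ⟨K, hK⟩ := isCompact_Icc.exists_bound_of_continuousOn hf.continuousOn
  exact ⟨K, fun v hv => hK v (torus_subset_Icc hv)⟩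

theorem isBigO_one_snd_of_continuous {ι E : Type*} {d : ℕ} [SeminormedAddCommGroup E]
    (𝓕 : Filter ι) {f : (Fin d → ℝ) → E} (hf : Continuous f) :
    (fun p : ι × (Fin d → ℝ) => f p.2) =O[𝓕 ×ˢ 𝓟 (torus d)] fun _ => (1 : ℝ) := by
  obtain ⟨K, hK⟩ := exists_forall_mem_torus_norm_le hf
  refine IsBigO.of_bound K ?_
  filter_upwards [tendsto_snd.eventually (eventually_principal.2 hK)] with p hp
  simpa using hp

theorem continuous_nonsing_inv {X n : Type*} [TopologicalSpace X] [Fintype n] [DecidableEq n]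
    {f : X → Matrix n n ℂ} (hf : Continuous f) (hu : ∀ x, IsUnit (f x)) :
    Continuous fun x => (f x)⁻¹ := by
  simp only [Matrix.inv_def, Ring.inverse_eq_inv']
  exact (hf.matrix_det.inv₀ fun x => ((Matrix.isUnit_iff_isUnit_det _).1 (hu x)).ne_zero).smul
    hf.matrix_adjugate

variable {d : ℕ} {Ω : Type*} [MeasurableSpace Ω] {μ : Measure Ω} {r : CoinIdx d → Fin d → ℤ}
  {C : Ω → Matrix (CoinIdx d) (CoinIdx d) ℂ} [IsProbabilityMeasure μ] [NeZero d]

namespace IsRandomUnitary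

variable (hC : IsRandomUnitary C) (hS : AssumptionS μ r C)
include hC hS

theorem continuous_reducedResolvent :
    Continuous fun v => reducedResolvent (avgMatrix μ r C (-v) v) (projPsi d) 1 := by
  simp only [reducedResolvent, one_smul]
  refine (continuous_nonsing_inv ?_ (hC.isUnit_restMatrix_sub_one hS)).mul continuous_const
  exact (continuous_avgMatrix_neg_self.sub continuous_const).sub continuous_const

theorem continuous_corrector :
    Continuous fun v => corrector (avgMatrix μ r C (-v) v) (projPsi d) :=
  continuous_const.sub (hC.continuous_reducedResolvent hS)

theorem continuous_diffusionMatrix : Continuous fun v => diffusionMatrix μ r C v := by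
  refine continuous_matrix fun i j => continuous_const.sub (continuous_const.mul ?_)
  exact continuous_finsetSum _ fun τ _ => continuous_finsetSum _ fun τ' _ =>
    continuous_const.mul ((hC.continuous_reducedResolvent hS).matrix_elem _ _)

theorem continuous_quadForm_diffusionMatrix (z : Fin d → ℂ) :
    Continuous fun v => quadForm (diffusionMatrix μ r C v) z :=
  continuous_const.dotProduct ((hC.continuous_diffusionMatrix hS).matrix_mulVec continuous_const)

theorem exists_forall_norm_quadForm_diffusionMatrix_le :
    ∃ K, ∀ v ∈ torus d, ∀ z, ‖quadForm (diffusionMatrix μ r C v) z‖ ≤ K * ‖z‖ ^ 2 := by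
  have hcont : Continuous fun v => ∑ i, ∑ j, ‖diffusionMatrix μ r C v i j‖ :=
    continuous_finsetSum _ fun i _ => continuous_finsetSum _ fun j _ =>
      ((hC.continuous_diffusionMatrix hS).matrix_elem i j).norm
  obtain ⟨K, hK⟩ := exists_forall_mem_torus_norm_le hcont
  refine ⟨K, fun v hv z => (norm_quadForm_le _ z).trans ?_⟩
  gcongr
  exact (le_abs_self _).trans (hK v hv)

end IsRandomUnitary

end Continuity

section CenteredPhase

open scoped Matrix.Norms.L2Operator

theorem isBigO_diagonal {X n : Type*} [Fintype n] [DecidableEq n] {𝓕 : Filter X}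
    {f : X → n → ℂ} {g : X → ℝ} (hf : ∀ i, (fun x => f x i) =O[𝓕] g) :
    (fun x => Matrix.diagonal (f x)) =O[𝓕] g := by
  rw [← isBigO_norm_left]
  simp only [Matrix.l2_opNorm_diagonal]
  exact (isBigO_pi.2 hf).norm_left

variable {d : ℕ} (r : CoinIdx d → Fin d → ℤ)

/-- The diagonal matrix with entries `exp (i z·(r(τ) - r̄))` on `τ ⊗ τ'`: the matrix
`D(z, 0)` of the walk with the drift `r̄` removed. -/
noncomputable def centeredPhase (z : Fin d → ℂ) :
    Matrix (CoinIdx d × CoinIdx d) (CoinIdx d × CoinIdx d) ℂ :=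
  Matrix.diagonal fun T => Complex.exp (Complex.I * (z ⬝ᵥ centeredJump r T.1))

variable {X : Type*} {𝓕 : Filter X} {z : X → Fin d → ℂ}

theorem isBigO_dotProduct_norm (a : Fin d → ℂ) : (fun x => z x ⬝ᵥ a) =O[𝓕] fun x => ‖z x‖ := by
  simp only [dotProduct]
  refine IsBigO.fun_sum fun j _ => ?_
  simpa [mul_comm] using (IsBigO.of_bound 1 (Eventually.of_forall fun x => by
    simpa using norm_le_pi_norm (z x) j) : (fun x => z x j) =O[𝓕] fun x => ‖z x‖).const_mul_left
    (a j)

theorem isBigO_centeredDiag : (fun x => centeredDiag r (z x)) =O[𝓕] fun x => ‖z x‖ :=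
  isBigO_diagonal fun _ => (isBigO_dotProduct_norm _).const_mul_left _

theorem isBigO_centeredPhase_sub (hz : Tendsto z 𝓕 (𝓝 0)) :
    (fun x => centeredPhase r (z x) - (1 + centeredDiag r (z x)
        + (1 / 2 : ℂ) • (centeredDiag r (z x) * centeredDiag r (z x))))
      =O[𝓕] fun x => ‖z x‖ ^ 3 := by
  have hO (T : CoinIdx d × CoinIdx d) :
      (fun x => Complex.I * (z x ⬝ᵥ centeredJump r T.1)) =O[𝓕] fun x => ‖z x‖ :=
    (isBigO_dotProduct_norm _).const_mul_left _
  have htaylor (T : CoinIdx d × CoinIdx d) :=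
    ((Complex.exp_sub_sum_range_isBigO_pow 3).comp_tendsto
      ((hO T).trans_tendsto (tendsto_norm_zero.comp hz))).trans ((hO T).pow 3)
  refine (isBigO_diagonal htaylor).congr_left fun x => ?_
  rw [← Matrix.diagonal_one, centeredPhase, centeredDiag, Matrix.diagonal_mul_diagonal,
    ← Matrix.diagonal_smul, Matrix.diagonal_add, Matrix.diagonal_add, Matrix.diagonal_sub]
  congr 1
  ext T
  simp [Finset.sum_range_succ]
  ring

end CenteredPhase

section Amplitude

variable {d : ℕ} (r : CoinIdx d → Fin d → ℤ) (φ₀ : CoinSpace d)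

/-- The amplitude `⟨τ ⊗ k, U(n, 0) ψ₀⟩` of the walk at the coin state `τ` and the site `k`. -/
noncomputable def amplitude (C : ℕ → Matrix (CoinIdx d) (CoinIdx d) ℂ) (n : ℕ) (k : Fin d → ℤ)
    (τ : CoinIdx d) : ℂ :=
  evolution r C n (lp.single 2 (0 : Fin d → ℤ) φ₀) k τ

theorem amplitude_zero (C : ℕ → Matrix (CoinIdx d) (CoinIdx d) ℂ) (k : Fin d → ℤ)
    (τ : CoinIdx d) : amplitude r φ₀ C 0 k τ = if k = 0 then φ₀ τ else 0 := by
  by_cases hk : k = 0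
  · subst hk; simp [amplitude, evolution]
  · simp [amplitude, evolution, hk]

theorem amplitude_succ (C : ℕ → Matrix (CoinIdx d) (CoinIdx d) ℂ) (n : ℕ) (k : Fin d → ℤ)
    (τ : CoinIdx d) :
    amplitude r φ₀ C (n + 1) k τ = ∑ σ, C n τ σ * amplitude r φ₀ C n (k - r τ) σ := by
  simp [amplitude, evolution, shiftOp, coinOp, Matrix.toLpLin_apply, Matrix.mulVec, dotProduct]

theorem amplitude_succ_mul_star_amplitude_succ (C : ℕ → Matrix (CoinIdx d) (CoinIdx d) ℂ) (n : ℕ)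
    (k k' : Fin d → ℤ) (τ τ' : CoinIdx d) :
    amplitude r φ₀ C (n + 1) k τ * star (amplitude r φ₀ C (n + 1) k' τ')
      = ∑ T : CoinIdx d × CoinIdx d, (C n τ T.1 * star (C n τ' T.2))
        * (amplitude r φ₀ C n (k - r τ) T.1 * star (amplitude r φ₀ C n (k' - r τ') T.2)) := by
  rw [amplitude_succ, amplitude_succ, star_sum, Finset.sum_mul_sum, ← Fintype.sum_prod_type']
  refine Finset.sum_congr rfl fun T _ => ?_
  rw [star_mul]
  ring

theorem prob_eq_sum_amplitude (C : ℕ → Matrix (CoinIdx d) (CoinIdx d) ℂ) (n : ℕ)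
    (k : Fin d → ℤ) :
    (prob r C φ₀ n k : ℂ)
      = ∑ τ, amplitude r φ₀ C n k τ * star (amplitude r φ₀ C n k τ) := by
  rw [prob, EuclideanSpace.norm_sq_eq]
  push_cast
  refine Finset.sum_congr rfl fun τ _ => ?_
  rw [Complex.star_def, Complex.mul_conj', amplitude]

theorem exists_forall_norm_amplitude_le (n : ℕ) :
    ∃ B : ℝ, ∀ C : ℕ → Matrix (CoinIdx d) (CoinIdx d) ℂ, (∀ i σ τ, ‖C i σ τ‖ ≤ 1) →
      ∀ k τ, ‖amplitude r φ₀ C n k τ‖ ≤ B := by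
  induction n with
  | zero =>
    refine ⟨‖φ₀‖, fun C _ k τ => ?_⟩
    rw [amplitude_zero]
    split_ifs
    · exact PiLp.norm_apply_le φ₀ τ
    · simp
  | succ n ih =>
    obtain ⟨B, hB⟩ := ih
    refine ⟨∑ _σ : CoinIdx d, 1 * B, fun C hC k τ => ?_⟩
    rw [amplitude_succ]
    exact norm_sum_le_of_le _ fun σ _ => norm_mul_le_of_le (hC n τ σ) (hB C hC _ σ)

theorem measurable_amplitude {Ω' : Type*} {m' : MeasurableSpace Ω'}
    {C : Ω' → ℕ → Matrix (CoinIdx d) (CoinIdx d) ℂ} {n : ℕ}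
    (hC : ∀ i < n, ∀ σ τ, Measurable fun ω => C ω i σ τ) (k : Fin d → ℤ) (τ : CoinIdx d) :
    Measurable fun ω => amplitude r φ₀ (C ω) n k τ := by
  induction n generalizing k τ with
  | zero => simp only [amplitude_zero]; exact measurable_const
  | succ n ih =>
    simp only [amplitude_succ]
    exact Finset.measurable_fun_sum _ fun σ _ => (hC n n.lt_succ_self τ σ).mul
      (ih (fun i hi => hC i (hi.trans n.lt_succ_self)) _ σ)

end Amplitude

section Independence

variable {Ω : Type*} [MeasurableSpace Ω] {μ : Measure Ω} [IsProbabilityMeasure μ]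

/-- The σ-algebra on `Ω^ℕ` generated by the coordinates of index less than `n`. -/
@[reducible]
def strictPast (Ω : Type*) [MeasurableSpace Ω] (n : ℕ) : MeasurableSpace (ℕ → Ω) :=
  ⨆ i ∈ Set.Iio n, MeasurableSpace.comap (fun ω : ℕ → Ω => ω i) inferInstance

theorem measurable_eval_strictPast {i n : ℕ} (hi : i < n) :
    Measurable[strictPast Ω n] fun ω : ℕ → Ω => ω i :=
  (comap_measurable _).mono (le_iSup₂_of_le i hi le_rfl) le_rfl

theorem indepFun_eval_of_measurable_strictPast {β : Type*} [MeasurableSpace β] {n : ℕ}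
    {g : (ℕ → Ω) → β} (hg : Measurable[strictPast Ω n] g) :
    ProbabilityTheory.IndepFun (fun ω : ℕ → Ω => ω n) g (Measure.infinitePi fun _ => μ) := by
  have hindep : ProbabilityTheory.iIndepFun (fun (i : ℕ) (ω : ℕ → Ω) => ω i)
      (Measure.infinitePi fun _ => μ) :=
    ProbabilityTheory.iIndepFun_infinitePi (X := fun _ ω => ω) fun _ => measurable_id
  have hdisj := ProbabilityTheory.indep_iSup_of_disjoint
    (fun i => (measurable_pi_apply i).comap_le) hindep (S := {n}) (T := Set.Iio n) (by simp)
  rw [ProbabilityTheory.IndepFun_iff_Indep]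
  exact ProbabilityTheory.indep_of_indep_of_le_left
    (ProbabilityTheory.indep_of_indep_of_le_right hdisj hg.comap_le) (le_iSup₂_of_le n rfl le_rfl)

theorem integral_mul_of_measurable_strictPast {f : Ω → ℂ} (hf : Measurable f) {n : ℕ}
    {g : (ℕ → Ω) → ℂ} (hg : Measurable[strictPast Ω n] g) :
    ∫ ω, f (ω n) * g ω ∂(Measure.infinitePi fun _ : ℕ => μ)
      = (∫ ω, f ω ∂μ) * ∫ ω, g ω ∂(Measure.infinitePi fun _ : ℕ => μ) := by
  have hpast : strictPast Ω n ≤ MeasurableSpace.pi :=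
    iSup₂_le fun i _ => (measurable_pi_apply i).comap_le
  have hmp := measurePreserving_eval_infinitePi (fun _ : ℕ => μ) n
  have hindep : ProbabilityTheory.IndepFun (fun ω : ℕ → Ω => f (ω n)) g
      (Measure.infinitePi fun _ => μ) :=
    (indepFun_eval_of_measurable_strictPast hg).comp hf measurable_id
  rw [hindep.integral_fun_mul_eq_mul_integral
    (hf.comp (measurable_pi_apply n)).aestronglyMeasurable
    (hg.mono hpast le_rfl).aestronglyMeasurable]
  congr 1
  conv_rhs => rw [← hmp.map_eq]
  rw [integral_map hmp.measurable.aemeasurable hf.aestronglyMeasurable]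

end Independence

section Correlation

variable {d : ℕ} {Ω : Type*} [MeasurableSpace Ω] (μ : Measure Ω) [IsProbabilityMeasure μ]
  (r : CoinIdx d → Fin d → ℤ) (C : Ω → Matrix (CoinIdx d) (CoinIdx d) ℂ) (φ₀ : CoinSpace d)

/-- The coordinates of `φ₀ ⊗ conj φ₀`. -/
def initialDensity (S : CoinIdx d × CoinIdx d) : ℂ := φ₀ S.1 * star (φ₀ S.2)

/-- The averaged density matrix of the walk after `n` steps: its entry between `τ ⊗ k` and
`τ' ⊗ k'` is `𝔼 (ψ_n(k, τ) conj ψ_n(k', τ'))`. -/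
noncomputable def correlation (n : ℕ) (p : (Fin d → ℤ) × (Fin d → ℤ))
    (S : CoinIdx d × CoinIdx d) : ℂ :=
  ∫ ω, amplitude r φ₀ (fun s => C (ω s)) n p.1 S.1
    * star (amplitude r φ₀ (fun s => C (ω s)) n p.2 S.2) ∂(Measure.infinitePi fun _ : ℕ => μ)

theorem correlation_zero (p : (Fin d → ℤ) × (Fin d → ℤ)) (S : CoinIdx d × CoinIdx d) :
    correlation μ r C φ₀ 0 p S = if p = 0 then initialDensity φ₀ S else 0 := by
  simp only [correlation, amplitude_zero, integral_const, probReal_univ, one_smul]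
  by_cases h₁ : p.1 = 0 <;> by_cases h₂ : p.2 = 0 <;>
    simp [h₁, h₂, Prod.ext_iff, initialDensity]

variable {C}

namespace IsRandomUnitary

variable (hC : IsRandomUnitary C)
include hC

theorem integrable_amplitude_mul_star (n : ℕ) (p : (Fin d → ℤ) × (Fin d → ℤ))
    (S : CoinIdx d × CoinIdx d) :
    Integrable (fun ω => amplitude r φ₀ (fun s => C (ω s)) n p.1 S.1
      * star (amplitude r φ₀ (fun s => C (ω s)) n p.2 S.2))
      (Measure.infinitePi fun _ : ℕ => μ) := by
  obtain ⟨B, hB⟩ := exists_forall_norm_amplitude_le r φ₀ n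
  have hmeas (k : Fin d → ℤ) (τ : CoinIdx d) :
      Measurable fun ω : ℕ → Ω => amplitude r φ₀ (fun s => C (ω s)) n k τ :=
    measurable_amplitude r φ₀ (fun i _ σ τ => (hC.measurable_apply σ τ).comp
      (measurable_pi_apply i)) k τ
  refine Integrable.of_bound (C := B * B)
    ((hmeas _ _).mul (continuous_star.measurable.comp (hmeas _ _))).aestronglyMeasurable
    (ae_of_all _ fun ω => norm_mul_le_of_le (hB _ (fun i => hC.norm_apply_le (ω i)) _ _) ?_)
  rw [norm_star]
  exact hB _ (fun i => hC.norm_apply_le (ω i)) _ _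

theorem correlation_succ (n : ℕ) (p : (Fin d → ℤ) × (Fin d → ℤ)) (S : CoinIdx d × CoinIdx d) :
    correlation μ r C φ₀ (n + 1) p S
      = ∑ T, avgCoin μ C S T * correlation μ r C φ₀ n (p - (r S.1, r S.2)) T := by
  set q := p - (r S.1, r S.2)
  have hcoin (i : ℕ) (hi : i < n) (σ τ : CoinIdx d) :
      Measurable[strictPast Ω n] fun ω : ℕ → Ω => C (ω i) σ τ :=
    (hC.measurable_apply σ τ).comp (measurable_eval_strictPast hi)
  have hpast (T : CoinIdx d × CoinIdx d) : Measurable[strictPast Ω n] fun ω =>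
      amplitude r φ₀ (fun s => C (ω s)) n q.1 T.1
        * star (amplitude r φ₀ (fun s => C (ω s)) n q.2 T.2) :=
    (measurable_amplitude r φ₀ hcoin _ _).mul
      (continuous_star.measurable.comp (measurable_amplitude r φ₀ hcoin _ _))
  have hint (T : CoinIdx d × CoinIdx d) : Integrable (fun ω : ℕ → Ω =>
      C (ω n) S.1 T.1 * star (C (ω n) S.2 T.2) * (amplitude r φ₀ (fun s => C (ω s)) n q.1 T.1
        * star (amplitude r φ₀ (fun s => C (ω s)) n q.2 T.2))) (Measure.infinitePi fun _ => μ) :=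
    (hC.integrable_amplitude_mul_star μ r φ₀ n q T).bdd_mul
      ((hC.measurable_mul_star _ _ _ _).comp (measurable_pi_apply n)).aestronglyMeasurable
      (ae_of_all _ fun ω => norm_mul_le_of_le (hC.norm_apply_le (ω n) S.1 T.1)
        ((norm_star _).trans_le (hC.norm_apply_le (ω n) S.2 T.2)))
  simp only [correlation, amplitude_succ_mul_star_amplitude_succ]
  refine (integral_finsetSum _ fun T _ => hint T).trans (Finset.sum_congr rfl fun T _ => ?_)
  rw [avgCoin_apply]
  exact integral_mul_of_measurable_strictPast (hC.measurable_mul_star S.1 T.1 S.2 T.2) (hpast T)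

theorem avgProb_eq_sum_correlation (n : ℕ) (k : Fin d → ℤ) :
    (avgProb μ r C φ₀ n k : ℂ) = ∑ τ, correlation μ r C φ₀ n (k, k) (τ, τ) := by
  rw [avgProb, ← integral_complex_ofReal]
  simp only [prob_eq_sum_amplitude]
  exact integral_finsetSum Finset.univ fun τ _ =>
    hC.integrable_amplitude_mul_star μ r φ₀ n (k, k) (τ, τ)

end IsRandomUnitary

omit [IsProbabilityMeasure μ] in
theorem correlation_eq_zero_of_prob_eq_zero {n : ℕ} {p : (Fin d → ℤ) × (Fin d → ℤ)}
    (hp : ∀ C, prob r C φ₀ n p.1 = 0 ∨ prob r C φ₀ n p.2 = 0) (S : CoinIdx d × CoinIdx d) :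
    correlation μ r C φ₀ n p S = 0 := by
  have hamp {C} {k : Fin d → ℤ} (h : prob r C φ₀ n k = 0) (τ : CoinIdx d) :
      amplitude r φ₀ C n k τ = 0 := by
    rw [prob, sq_eq_zero_iff, norm_eq_zero] at h
    rw [amplitude, h, PiLp.zero_apply]
  have hzero (ω : ℕ → Ω) : amplitude r φ₀ (fun s => C (ω s)) n p.1 S.1
      * star (amplitude r φ₀ (fun s => C (ω s)) n p.2 S.2) = 0 := by
    rcases hp fun s => C (ω s) with h | h <;> simp [hamp h]
  simp only [correlation, hzero, integral_zero]

end Correlation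

section Character

variable {d : ℕ}

/-- The character `k ↦ e^{i a·k}` of `ℤ^d`. -/
noncomputable def character (a : Fin d → ℂ) (k : Fin d → ℤ) : ℂ :=
  Complex.exp (Complex.I * ∑ j, a j * (k j : ℂ))

theorem character_zero_right (a : Fin d → ℂ) : character a 0 = 1 := by simp [character]

theorem character_add_right (a : Fin d → ℂ) (k l : Fin d → ℤ) :
    character a (k + l) = character a k * character a l := by
  simp only [character, Pi.add_apply, Int.cast_add, mul_add, Finset.sum_add_distrib,
    Complex.exp_add]

theorem character_add_left (a b : Fin d → ℂ) (k : Fin d → ℤ) :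
    character (a + b) k = character a k * character b k := by
  simp only [character, Pi.add_apply, add_mul, Finset.sum_add_distrib, mul_add, Complex.exp_add]

theorem character_neg_right (a : Fin d → ℂ) (k : Fin d → ℤ) :
    character a (-k) = character (-a) k := by
  simp only [character, Pi.neg_apply, Int.cast_neg, mul_neg, neg_mul]

theorem continuous_character_ofReal (k : Fin d → ℤ) :
    Continuous fun v : Fin d → ℝ => character (fun j => (v j : ℂ)) k := by
  unfold character
  fun_prop

theorem IsRandomUnitary.hasSum_correlation {Ω : Type*} [MeasurableSpace Ω] (μ : Measure Ω)
    [IsProbabilityMeasure μ] (r : CoinIdx d → Fin d → ℤ)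
    {C : Ω → Matrix (CoinIdx d) (CoinIdx d) ℂ} (φ₀ : CoinSpace d) (hC : IsRandomUnitary C)
    (a b : Fin d → ℂ) (n : ℕ) (S : CoinIdx d × CoinIdx d) :
    HasSum (fun p : (Fin d → ℤ) × (Fin d → ℤ) =>
        character a p.1 * character b p.2 * correlation μ r C φ₀ n p S)
      (((Matrix.diagonal (fun T : CoinIdx d × CoinIdx d =>
        character a (r T.1) * character b (r T.2)) * avgCoin μ C) ^ n *ᵥ initialDensity φ₀) S) := by
  induction n generalizing S with
  | zero =>
    have h := hasSum_single (f := fun p : (Fin d → ℤ) × (Fin d → ℤ) =>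
      character a p.1 * character b p.2 * correlation μ r C φ₀ 0 p S) 0
      fun p hp => by rw [correlation_zero, if_neg hp, mul_zero]
    simpa [correlation_zero, character_zero_right] using h
  | succ n ih =>
    have h := (hasSum_sum fun T (_ : T ∈ Finset.univ) => (ih T).mul_left (avgCoin μ C S T)).mul_left
      (character a (r S.1) * character b (r S.2))
    rw [← (Equiv.subRight ((r S.1, r S.2) : (Fin d → ℤ) × (Fin d → ℤ))).hasSum_iff] at h
    rw [pow_succ', ← Matrix.mulVec_mulVec, ← Matrix.mulVec_mulVec, Matrix.mulVec_diagonal]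
    refine h.congr_fun fun p => ?_
    have ha : character a p.1 = character a (r S.1) * character a (p.1 - r S.1) := by
      rw [← character_add_right, add_sub_cancel]
    have hb : character b p.2 = character b (r S.2) * character b (p.2 - r S.2) := by
      rw [← character_add_right, add_sub_cancel]
    simp only [Function.comp_apply, Equiv.subRight_apply, hC.correlation_succ μ, ha, hb,
      Finset.mul_sum, Prod.fst_sub, Prod.snd_sub]
    exact Finset.sum_congr rfl fun T _ => by ring

end Character

section TorusIntegral

variable {d : ℕ}

theorem volume_real_torus : volume.real (torus d) = (2 * Real.pi) ^ d := by
  rw [Measure.real, torus, Real.volume_pi_Ico, ENNReal.toReal_prod]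
  simp [Real.pi_pos.le]

theorem volume_torus_lt_top : volume (torus d) < ⊤ :=
  (measure_mono torus_subset_Icc).trans_lt isCompact_Icc.measure_lt_top

theorem integrableOn_torus {E : Type*} [NormedAddCommGroup E] {f : (Fin d → ℝ) → E}
    (hf : Continuous f) : IntegrableOn f (torus d) :=
  (hf.continuousOn.integrableOn_compact isCompact_Icc).mono_set torus_subset_Icc

theorem torusInt_const (c : ℂ) : torusInt (fun _ : Fin d → ℝ => c) = c := by
  have h : (((2 * Real.pi) ^ d : ℝ) : ℂ) ≠ 0 :=
    Complex.ofReal_ne_zero.2 (pow_pos Real.two_pi_pos d).ne'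
  rw [torusInt, setIntegral_const, volume_real_torus, Complex.real_smul, inv_mul_cancel_left₀ h]

theorem torusInt_add {f g : (Fin d → ℝ) → ℂ} (hf : Continuous f) (hg : Continuous g) :
    torusInt (fun v => f v + g v) = torusInt f + torusInt g := by
  rw [torusInt, integral_add (integrableOn_torus hf) (integrableOn_torus hg), mul_add]
  rfl

theorem torusInt_sub {f g : (Fin d → ℝ) → ℂ} (hf : Continuous f) (hg : Continuous g) :
    torusInt (fun v => f v - g v) = torusInt f - torusInt g := by
  rw [torusInt, integral_sub (integrableOn_torus hf) (integrableOn_torus hg), mul_sub]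
  rfl

theorem torusInt_const_mul (c : ℂ) (f : (Fin d → ℝ) → ℂ) :
    torusInt (fun v => c * f v) = c * torusInt f := by
  rw [torusInt, integral_const_mul, torusInt]
  ring

theorem torusInt_finsetSum {ι : Type*} (s : Finset ι) {f : ι → (Fin d → ℝ) → ℂ}
    (hf : ∀ i ∈ s, Continuous (f i)) :
    torusInt (fun v => ∑ i ∈ s, f i v) = ∑ i ∈ s, torusInt (f i) := by
  rw [torusInt, integral_finsetSum _ fun i hi => integrableOn_torus (hf i hi), Finset.mul_sum]
  rfl

theorem norm_torusInt_le {f : (Fin d → ℝ) → ℂ} {K : ℝ} (hf : ∀ v ∈ torus d, ‖f v‖ ≤ K) :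
    ‖torusInt f‖ ≤ K := by
  have hpos : 0 < (2 * Real.pi) ^ d := pow_pos Real.two_pi_pos d
  have h := norm_setIntegral_le_of_norm_le_const volume_torus_lt_top hf
  rwa [torusInt, norm_mul, norm_inv, Complex.norm_real, Real.norm_of_nonneg hpos.le,
    inv_mul_le_iff₀ hpos, mul_comm, ← volume_real_torus]

theorem integral_exp_int_mul (m : ℤ) :
    ∫ x in Set.Ico (0 : ℝ) (2 * Real.pi), Complex.exp (Complex.I * (x * m))
      = if m = 0 then 2 * Real.pi else 0 := by
  rw [integral_Ico_eq_integral_Ioc, ← intervalIntegral.integral_of_le Real.two_pi_pos.le]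
  split_ifs with hm
  · simp [hm]
  · have hc : Complex.I * (m : ℂ) ≠ 0 := mul_ne_zero Complex.I_ne_zero (by exact_mod_cast hm)
    have hperiod : Complex.exp (Complex.I * m * ((2 * Real.pi : ℝ) : ℂ)) = 1 :=
      Complex.exp_eq_one_iff.2 ⟨m, by push_cast; ring⟩
    simp_rw [mul_comm ((_ : ℝ) : ℂ) (m : ℂ), ← mul_assoc]
    rw [integral_exp_mul_complex hc, hperiod]
    simp

theorem torusInt_character (k : Fin d → ℤ) :
    torusInt (fun v => character (fun j => (v j : ℂ)) k) = if k = 0 then 1 else 0 := by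
  simp only [torusInt, character, Finset.mul_sum, Complex.exp_sum]
  rw [torus, volume_pi, Measure.restrict_pi_pi, integral_fintype_prod_eq_prod
    (f := fun j (x : ℝ) => Complex.exp (Complex.I * (x * (k j : ℂ))))]
  simp_rw [integral_exp_int_mul]
  split_ifs with hk
  · simp only [hk, Pi.zero_apply, if_true, Finset.prod_const, Finset.card_univ, Fintype.card_fin,
      ← Complex.ofReal_pow]
    exact inv_mul_cancel₀ (Complex.ofReal_ne_zero.2 (pow_pos Real.two_pi_pos d).ne')
  · obtain ⟨j, hj⟩ := Function.ne_iff.1 hk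
    rw [Finset.prod_eq_zero (Finset.mem_univ j), mul_zero]
    rw [if_neg (show k j ≠ 0 from hj), Complex.ofReal_zero]

end TorusIntegral

section FourierFormula

variable {d : ℕ} {Ω : Type*} [MeasurableSpace Ω] (μ : Measure Ω)
  (r : CoinIdx d → Fin d → ℤ) (C : Ω → Matrix (CoinIdx d) (CoinIdx d) ℂ) (φ₀ : CoinSpace d)

/-- The diagonal matrix `D(y, 0)` with entries `e^{i y·r(τ)}` on `τ ⊗ τ'`, for complex `y`. -/
noncomputable def leftPhase (y : Fin d → ℂ) :
    Matrix (CoinIdx d × CoinIdx d) (CoinIdx d × CoinIdx d) ℂ :=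
  Matrix.diagonal fun T => character y (r T.1)

theorem leftPhase_mul_phase (y : Fin d → ℂ) (v : Fin d → ℝ) :
    leftPhase r y * phase r (-v) v = Matrix.diagonal fun T =>
      character (y - fun j => (v j : ℂ)) (r T.1) * character (fun j => (v j : ℂ)) (r T.2) := by
  rw [leftPhase, phase, Matrix.diagonal_mul_diagonal]
  congr 1
  ext T
  simp only [character, ← Complex.exp_add, ← mul_add, ← Finset.sum_add_distrib]
  push_cast
  rw [← Finset.sum_add_distrib]
  congr 2
  exact Finset.sum_congr rfl fun j _ => by simp only [Pi.neg_apply, Pi.sub_apply]; push_cast; ring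

theorem centeredPhase_eq_smul_leftPhase (z : Fin d → ℂ) :
    centeredPhase r z
      = Complex.exp (-(Complex.I * (z ⬝ᵥ fun j => (meanJump r j : ℂ)))) • leftPhase r z := by
  rw [centeredPhase, leftPhase, ← Matrix.diagonal_smul]
  congr 1
  ext T
  rw [Pi.smul_apply, smul_eq_mul, character, ← Complex.exp_add, dotProduct_centeredJump, mul_sub,
    sub_eq_neg_add]
  rfl

/-- The linear form `X ↦ ∑_τ ⟨τ ⊗ τ, X (φ₀ ⊗ conj φ₀)⟩`, which takes the trace over the coin. -/
noncomputable def traceForm :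
    Matrix (CoinIdx d × CoinIdx d) (CoinIdx d × CoinIdx d) ℂ →ₗ[ℂ] ℂ where
  toFun X := diagVec (CoinIdx d) ⬝ᵥ X *ᵥ initialDensity φ₀
  map_add' X Y := by rw [Matrix.add_mulVec, dotProduct_add]
  map_smul' c X := by rw [Matrix.smul_mulVec, dotProduct_smul, RingHom.id_apply]

theorem traceForm_apply (X : Matrix (CoinIdx d × CoinIdx d) (CoinIdx d × CoinIdx d) ℂ) :
    traceForm φ₀ X = diagVec (CoinIdx d) ⬝ᵥ X *ᵥ initialDensity φ₀ :=
  rfl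

theorem traceForm_projPsi_mul [NeZero d]
    (X : Matrix (CoinIdx d × CoinIdx d) (CoinIdx d × CoinIdx d) ℂ) :
    traceForm φ₀ (projPsi d * X) = traceForm φ₀ X := by
  rw [traceForm_apply, ← Matrix.mulVec_mulVec, Matrix.dotProduct_mulVec, diagVec_vecMul_projPsi,
    traceForm_apply]

variable {φ₀} in
theorem traceForm_one (hφ₀ : ‖φ₀‖ = 1) : traceForm φ₀ 1 = 1 := by
  have h : ((‖φ₀‖ ^ 2 : ℝ) : ℂ) = 1 := by rw [hφ₀]; simp
  rw [traceForm_apply, Matrix.one_mulVec, diagVec_dotProduct, ← h, EuclideanSpace.norm_sq_eq]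
  push_cast
  exact Finset.sum_congr rfl fun τ _ => Complex.mul_conj' (φ₀ τ)

variable [IsProbabilityMeasure μ]

variable {C} (hC : IsRandomUnitary C)
include hC

theorem IsRandomUnitary.traceForm_leftPhase_mul_avgMatrix_pow {n : ℕ} {F : Finset (Fin d → ℤ)}
    (hF : ∀ C, ∀ k ∉ F, prob r C φ₀ n k = 0) (y : Fin d → ℂ) (v : Fin d → ℝ) :
    traceForm φ₀ ((leftPhase r y * avgMatrix μ r C (-v) v) ^ n)
      = ∑ p ∈ F ×ˢ F, (character y p.1 * ∑ τ, correlation μ r C φ₀ n p (τ, τ))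
        * character (fun j => (v j : ℂ)) (p.2 - p.1) := by
  have hsum := hasSum_sum fun (τ : CoinIdx d) (_ : τ ∈ Finset.univ) =>
    hC.hasSum_correlation μ r φ₀ (y - fun j => (v j : ℂ)) (fun j => (v j : ℂ)) n (τ, τ)
  rw [traceForm_apply, avgMatrix, ← mul_assoc, leftPhase_mul_phase, diagVec_dotProduct]
  refine hsum.unique ((hasSum_sum_of_ne_finset_zero fun p hp => ?_).congr_fun fun p => ?_)
  · have hzero (τ : CoinIdx d) : correlation μ r C φ₀ n p (τ, τ) = 0 :=
      correlation_eq_zero_of_prob_eq_zero μ r φ₀ (fun C => by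
        rw [Finset.mem_product, not_and_or] at hp
        exact hp.imp (hF C _) (hF C _)) _
    simp only [hzero, Finset.sum_const_zero, mul_zero, zero_mul]
  · rw [sub_eq_add_neg y, sub_eq_add_neg p.2]
    simp only [character_add_left, character_add_right, character_neg_right, Finset.mul_sum,
      Finset.sum_mul]
    exact Finset.sum_congr rfl fun τ _ => by ring

theorem IsRandomUnitary.charFn_eq_torusInt (n : ℕ) (y : Fin d → ℂ) :
    charFn μ r C φ₀ n y
      = torusInt fun v => traceForm φ₀ ((leftPhase r y * avgMatrix μ r C (-v) v) ^ n) := by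
  obtain ⟨F, hF⟩ := exists_finset_prob_eq_zero r φ₀ n
  simp only [hC.traceForm_leftPhase_mul_avgMatrix_pow μ r φ₀ hF]
  have hcont (c : ℂ) (k : Fin d → ℤ) :
      Continuous fun v : Fin d → ℝ => c * character (fun j => (v j : ℂ)) k :=
    continuous_const.mul (continuous_character_ofReal k)
  rw [torusInt_finsetSum _ fun p _ => hcont _ _, Finset.sum_product]
  simp only [torusInt_const_mul, torusInt_character, sub_eq_zero, mul_ite, mul_one, mul_zero,
    Finset.sum_ite_eq']
  refine (tsum_eq_sum fun k hk => ?_).trans (Finset.sum_congr rfl fun k hk => ?_)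
  · simp only [avgProb, hF _ k hk, integral_zero, Complex.ofReal_zero, zero_mul]
  · rw [if_pos hk, hC.avgProb_eq_sum_correlation μ r φ₀, mul_comm]
    rfl

theorem IsRandomUnitary.exp_mul_charFn_eq_torusInt (n : ℕ) (z : Fin d → ℂ) :
    Complex.exp (-(Complex.I * n * (z ⬝ᵥ fun j => (meanJump r j : ℂ)))) * charFn μ r C φ₀ n z
      = torusInt fun v => traceForm φ₀ ((centeredPhase r z * avgMatrix μ r C (-v) v) ^ n) := by
  rw [hC.charFn_eq_torusInt μ r φ₀, ← torusInt_const_mul]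
  congr 1
  ext v
  rw [centeredPhase_eq_smul_leftPhase, smul_mul_assoc, smul_pow, map_smul, smul_eq_mul,
    ← Complex.exp_nat_mul]
  ring_nf

end FourierFormula

section EntireFunctions

open scoped ContDiff

theorem foldr_iterate_rel {α β ι : Type*} (A : ι → α → α) (B : ι → β → β) (R : α → β → Prop)
    (h : ∀ j a b, R a b → R (A j a) (B j b)) (s : ι → ℕ) (l : List ι) {a : α} {b : β}
    (hab : R a b) :
    R (l.foldr (fun j => (A j)^[s j]) a) (l.foldr (fun j => (B j)^[s j]) b) := by
  have hiterate (j : ι) (n : ℕ) {a : α} {b : β} (hab : R a b) : R ((A j)^[n] a) ((B j)^[n] b) := by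
    induction n with
    | zero => exact hab
    | succ n ih =>
      rw [Function.iterate_succ_apply', Function.iterate_succ_apply']
      exact h j _ _ ih
  induction l with
  | nil => exact hab
  | cons j l ih => exact hiterate j (s j) ih

variable {d : ℕ}

theorem contDiff_partialDeriv {g : (Fin d → ℂ) → ℂ} (hg : ContDiff ℂ ω g) (j : Fin d) :
    ContDiff ℂ ω (partialDeriv j g) :=
  (hg.fderiv_right (m := ω) le_top).clm_apply contDiff_const

theorem norm_partialDeriv_le {g : (Fin d → ℂ) → ℂ} (hg : Differentiable ℂ g) (j : Fin d)
    {y : Fin d → ℂ} {K : ℝ} (hK : ∀ w : ℂ, ‖w‖ = 1 → ‖g (y + w • Pi.single j 1)‖ ≤ K) :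
    ‖partialDeriv j g y‖ ≤ K := by
  have hline : Differentiable ℂ fun w : ℂ => g (y + w • Pi.single j 1) := by fun_prop
  rw [partialDeriv, ← ((hg y).hasFDerivAt.hasLineDerivAt _).deriv, ← div_one K]
  exact Complex.norm_deriv_le_of_forall_mem_sphere_norm_le one_pos hline.diffContOnCl
    fun w hw => hK w (mem_sphere_zero_iff_norm.1 hw)

theorem partialDeriv_sub {g h : (Fin d → ℂ) → ℂ} (hg : Differentiable ℂ g)
    (hh : Differentiable ℂ h) (j : Fin d) (y : Fin d → ℂ) :
    partialDeriv j (g - h) y = partialDeriv j g y - partialDeriv j h y := by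
  rw [partialDeriv, fderiv_sub (hg y) (hh y)]
  rfl

/-- Convergence of entire functions on `ℂ^d`, uniform on every compact set. -/
structure EntireTendsto {ι : Type*} (G : ι → (Fin d → ℂ) → ℂ) (𝓕 : Filter ι)
    (g : (Fin d → ℂ) → ℂ) : Prop where
  contDiff (i : ι) : ContDiff ℂ ω (G i)
  contDiff_lim : ContDiff ℂ ω g
  tendstoUniformlyOn {K : Set (Fin d → ℂ)} : IsCompact K → TendstoUniformlyOn G g 𝓕 K

namespace EntireTendsto

variable {ι : Type*} {G : ι → (Fin d → ℂ) → ℂ} {𝓕 : Filter ι} {g : (Fin d → ℂ) → ℂ}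

theorem tendsto (h : EntireTendsto G 𝓕 g) (y : Fin d → ℂ) : Tendsto (G · y) 𝓕 (𝓝 (g y)) :=
  (h.tendstoUniformlyOn isCompact_singleton).tendsto_at (Set.mem_singleton y)

theorem partialDeriv (h : EntireTendsto G 𝓕 g) (j : Fin d) :
    EntireTendsto (fun i => partialDeriv j (G i)) 𝓕 (partialDeriv j g) := by
  refine ⟨fun i => contDiff_partialDeriv (h.contDiff i) j, contDiff_partialDeriv h.contDiff_lim j,
    fun {K} hK => ?_⟩
  have hK' : IsCompact ((fun p : ℂ × (Fin d → ℂ) => p.2 + p.1 • (Pi.single j 1 : Fin d → ℂ)) ''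
      (Metric.closedBall 0 1 ×ˢ K)) :=
    ((isCompact_closedBall 0 1).prod hK).image (by fun_prop)
  rw [Metric.tendstoUniformlyOn_iff]
  intro ε hε
  filter_upwards [Metric.tendstoUniformlyOn_iff.1 (h.tendstoUniformlyOn hK') (ε / 2) (half_pos hε)]
    with i hi y hy
  have hg := h.contDiff_lim.differentiable (by simp)
  have hG := (h.contDiff i).differentiable (by simp)
  rw [dist_eq_norm, ← partialDeriv_sub hg hG]
  refine (norm_partialDeriv_le (hg.sub hG) j fun w hw => ?_).trans_lt (half_lt_self hε)
  have hmem := hi _ ⟨(w, y), ⟨mem_closedBall_zero_iff.2 hw.le, hy⟩, rfl⟩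
  exact (dist_eq_norm _ _).symm.trans_le hmem.le

theorem tendsto_mixedDeriv (h : EntireTendsto G 𝓕 g) (s : Fin d → ℕ) (y : Fin d → ℂ) :
    Tendsto (fun i => mixedDeriv s (G i) y) 𝓕 (𝓝 (mixedDeriv s g y)) := by
  have hmixed (i : ι) :=
    foldr_iterate_rel (fun j H i => RandomQW.partialDeriv j (H i)) RandomQW.partialDeriv
      (fun (H : ι → (Fin d → ℂ) → ℂ) h => H i = h)
      (fun j _ _ => congrArg (RandomQW.partialDeriv j)) s (List.finRange d) (a := G) rfl
  have hlim := foldr_iterate_rel (fun j H i => RandomQW.partialDeriv j (H i))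
    RandomQW.partialDeriv (fun H h => EntireTendsto H 𝓕 h) (fun j _ _ h => h.partialDeriv j) s
    (List.finRange d) h
  exact (hlim.tendsto y).congr fun i => congrFun (hmixed i) y

end EntireTendsto

open scoped BoundedContinuousFunction

/-- The continuous linear form `f ↦ ∫ f dṽ` on bounded continuous functions. -/
noncomputable def torusIntCLM : ((Fin d → ℝ) →ᵇ ℂ) →L[ℂ] ℂ :=
  LinearMap.mkContinuous
    { toFun := fun f => torusInt f
      map_add' := fun f g => torusInt_add f.continuous g.continuous
      map_smul' := fun c f => torusInt_const_mul c f } 1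
    fun f => (norm_torusInt_le fun v _ => f.norm_coe_le_norm v).trans_eq (one_mul _).symm

/-- A family of functions on `ℂ^d`, indexed by `ℝ^d`, that is entire as a map from `ℂ^d` to the
bounded continuous functions on `ℝ^d`. Differentiation of such a family commutes with integration
over the torus. -/
def IsEntireFamily (H : (Fin d → ℝ) → (Fin d → ℂ) → ℂ) : Prop :=
  ∃ Γ : (Fin d → ℂ) → ((Fin d → ℝ) →ᵇ ℂ), ContDiff ℂ ω Γ ∧ ∀ v y, Γ y v = H v y

theorem partialDeriv_clm_comp {V : Type*} [NormedAddCommGroup V] [NormedSpace ℂ V] (L : V →L[ℂ] ℂ)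
    {Γ : (Fin d → ℂ) → V} (hΓ : Differentiable ℂ Γ) (j : Fin d) (y : Fin d → ℂ) :
    partialDeriv j (fun y => L (Γ y)) y = L (fderiv ℂ Γ y (Pi.single j 1)) := by
  have hcomp : HasFDerivAt (fun y => L (Γ y)) (L.comp (fderiv ℂ Γ y)) y :=
    L.hasFDerivAt.comp y (hΓ y).hasFDerivAt
  rw [partialDeriv, hcomp.fderiv, ContinuousLinearMap.comp_apply]

namespace IsEntireFamily

variable {H : (Fin d → ℝ) → (Fin d → ℂ) → ℂ}

theorem partialDeriv (hH : IsEntireFamily H) (j : Fin d) :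
    IsEntireFamily fun v => partialDeriv j (H v) := by
  obtain ⟨Γ, hΓ, hΓH⟩ := hH
  refine ⟨fun y => fderiv ℂ Γ y (Pi.single j 1),
    (hΓ.fderiv_right (m := ω) le_top).clm_apply contDiff_const, fun v y => ?_⟩
  have hv : (fun y => Γ y v) = H v := funext (hΓH v)
  simp only [← hv]
  exact (partialDeriv_clm_comp (BoundedContinuousFunction.evalCLM ℂ v)
    (hΓ.differentiable (by simp)) j y).symm

theorem partialDeriv_torusInt (hH : IsEntireFamily H) (j : Fin d) :
    RandomQW.partialDeriv j (fun y => torusInt (H · y))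
      = fun y => torusInt fun v => RandomQW.partialDeriv j (H v) y := by
  obtain ⟨Γ, hΓ, hΓH⟩ := hH
  ext y
  simp only [← funext (hΓH _)]
  refine (partialDeriv_clm_comp torusIntCLM (hΓ.differentiable (by simp)) j y).trans
    (congrArg torusInt (funext fun v => ?_))
  exact (partialDeriv_clm_comp (BoundedContinuousFunction.evalCLM ℂ v)
    (hΓ.differentiable (by simp)) j y).symm

theorem mixedDeriv_torusInt (hH : IsEntireFamily H) (s : Fin d → ℕ) :
    mixedDeriv s (fun y => torusInt (H · y)) = fun y => torusInt fun v => mixedDeriv s (H v) y := by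
  have hmixed (v : Fin d → ℝ) :=
    foldr_iterate_rel (fun j H v => RandomQW.partialDeriv j (H v)) RandomQW.partialDeriv
      (fun (H : (Fin d → ℝ) → (Fin d → ℂ) → ℂ) h => H v = h)
      (fun j _ _ => congrArg (RandomQW.partialDeriv j)) s (List.finRange d) (a := H) rfl
  have hint := foldr_iterate_rel RandomQW.partialDeriv
    (fun j H v => RandomQW.partialDeriv j (H v))
    (fun g H => IsEntireFamily H ∧ g = fun y => torusInt (H · y))
    (fun j _ _ h => ⟨h.1.partialDeriv j, by rw [h.2, h.1.partialDeriv_torusInt]⟩) s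
    (List.finRange d) ⟨hH, rfl⟩
  refine hint.2.trans (funext fun y => congrArg torusInt (funext fun v => ?_))
  exact congrFun (hmixed v) y

end IsEntireFamily

end EntireFunctions

section GaussianAverage

open scoped ContDiff BoundedContinuousFunction

variable {d : ℕ}

theorem exp_boundedContinuousFunction_apply {X : Type*} [TopologicalSpace X] (f : X →ᵇ ℂ) (x : X) :
    NormedSpace.exp f x = Complex.exp (f x) := by
  rw [Complex.exp_eq_exp_ℂ]
  exact NormedSpace.map_exp
    ((Pi.evalRingHom (fun _ => ℂ) x).comp (ContinuousMap.coeFnRingHom.comp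
      (BoundedContinuousFunction.toContinuousMapₐ ℂ : (X →ᵇ ℂ) →ₐ[ℂ] C(X, ℂ)).toRingHom))
    (BoundedContinuousFunction.evalCLM ℂ x).continuous f

/-- The family `(t, y) ↦ e^{-t ⟨y, A(v) y⟩ / 2}` as a function with values in the bounded continuous
functions of `v`, where it is visibly analytic. -/
noncomputable def gaussFamily {X : Type*} [TopologicalSpace X] (A : Fin d → Fin d → X →ᵇ ℂ)
    (p : ℂ × (Fin d → ℂ)) : X →ᵇ ℂ :=
  NormedSpace.exp (∑ i, ∑ j, (-(p.1 / 2) * (p.2 i * p.2 j)) • A i j)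

theorem gaussFamily_apply {X : Type*} [TopologicalSpace X] (A : Fin d → Fin d → X →ᵇ ℂ)
    (p : ℂ × (Fin d → ℂ)) (x : X) :
    gaussFamily A p x
      = Complex.exp (-(p.1 / 2) * quadForm (Matrix.of fun i j => A i j x) p.2) := by
  rw [gaussFamily, exp_boundedContinuousFunction_apply]
  congr 1
  simp only [BoundedContinuousFunction.coe_sum, Finset.sum_apply,
    BoundedContinuousFunction.coe_smul, quadForm, dotProduct, Matrix.mulVec, Matrix.of_apply,
    Finset.mul_sum, smul_eq_mul]
  exact Finset.sum_congr rfl fun i _ => Finset.sum_congr rfl fun j _ => by ring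

theorem contDiff_gaussFamily {X : Type*} [TopologicalSpace X] (A : Fin d → Fin d → X →ᵇ ℂ) :
    ContDiff ℂ ω (gaussFamily A) := by
  have hexp : ContDiff ℂ ω (NormedSpace.exp : (X →ᵇ ℂ) → X →ᵇ ℂ) :=
    contDiff_omega_iff_analyticOnNhd.2 fun f _ => NormedSpace.exp_analytic f
  exact hexp.comp (by fun_prop)

theorem quadForm_add_smul {A : Matrix (Fin d) (Fin d) ℂ} (hA : A.IsSymm) (y u : Fin d → ℂ) (w : ℂ) :
    quadForm A (y + w • u) = quadForm A y + 2 * w * (u ⬝ᵥ A *ᵥ y) + w ^ 2 * quadForm A u := by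
  have hsymm : y ⬝ᵥ A *ᵥ u = u ⬝ᵥ A *ᵥ y := by
    rw [Matrix.dotProduct_mulVec, ← Matrix.mulVec_transpose, hA.eq, dotProduct_comm]
  simp only [quadForm, Matrix.mulVec_add, Matrix.mulVec_smul, add_dotProduct, dotProduct_add,
    smul_dotProduct, dotProduct_smul, smul_eq_mul, hsymm]
  ring

theorem contDiff_quadForm (A : Matrix (Fin d) (Fin d) ℂ) : ContDiff ℂ ω (quadForm A) := by
  unfold quadForm dotProduct Matrix.mulVec dotProduct
  fun_prop

theorem partialDeriv_exp_quadForm {A : Matrix (Fin d) (Fin d) ℂ} (hA : A.IsSymm) (j : Fin d) :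
    partialDeriv j (fun y => Complex.exp (-(1 / 2) * quadForm A y))
      = fun y => -(A *ᵥ y) j * Complex.exp (-(1 / 2) * quadForm A y) := by
  ext y
  have hline : HasDerivAt (fun w : ℂ => -(1 / 2) * quadForm A (y + w • Pi.single j 1))
      (-(A *ᵥ y) j) 0 := by
    simp only [quadForm_add_smul hA, single_one_dotProduct]
    refine ((((((hasDerivAt_id (0 : ℂ)).const_mul 2).mul_const ((A *ᵥ y) j)).const_add
      (quadForm A y)).add (((hasDerivAt_id (0 : ℂ)).pow 2).mul_const
      (quadForm A (Pi.single j 1)))).const_mul (-(1 / 2))).congr_deriv ?_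
    simp
  have hdiff : Differentiable ℂ fun y => Complex.exp (-(1 / 2) * quadForm A y) :=
    (((contDiff_quadForm A).differentiable (by simp)).const_mul _).cexp
  refine ((hdiff y).hasFDerivAt.hasLineDerivAt _).unique (hline.cexp.congr_deriv ?_)
  rw [zero_smul, add_zero, mul_comm]

theorem partialDeriv_partialDeriv_exp_quadForm {A : Matrix (Fin d) (Fin d) ℂ} (hA : A.IsSymm)
    (i j : Fin d) :
    partialDeriv i (partialDeriv j fun y => Complex.exp (-(1 / 2) * quadForm A y)) 0 = -A i j := by
  have hdiff : Differentiable ℂ fun y => Complex.exp (-(1 / 2) * quadForm A y) :=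
    (((contDiff_quadForm A).differentiable (by simp)).const_mul _).cexp
  have hlin : HasFDerivAt (fun y : Fin d → ℂ => -(A *ᵥ y) j)
      (-((ContinuousLinearMap.proj j).comp (Matrix.mulVecLin A).toContinuousLinearMap)) 0 :=
    ContinuousLinearMap.hasFDerivAt (-((ContinuousLinearMap.proj j).comp
      (Matrix.mulVecLin A).toContinuousLinearMap))
  rw [partialDeriv_exp_quadForm hA, partialDeriv, (hlin.fun_mul (hdiff 0).hasFDerivAt).fderiv]
  simp [quadForm, hA.apply i j]

variable {Ω : Type*} [MeasurableSpace Ω] (μ : Measure Ω) (r : CoinIdx d → Fin d → ℤ)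
  (C : Ω → Matrix (CoinIdx d) (CoinIdx d) ℂ)

/-- The average over the torus of the Gaussian characteristic functions with covariance
`t 𝔻(v)`. -/
noncomputable def gaussAverage (t : ℂ) (y : Fin d → ℂ) : ℂ :=
  torusInt fun v => Complex.exp (-(t / 2) * quadForm (diffusionMatrix μ r C v) y)

theorem gaussAverage_zero_left (y : Fin d → ℂ) : gaussAverage μ r C 0 y = 1 := by
  simp only [gaussAverage, zero_div, neg_zero, zero_mul, Complex.exp_zero, torusInt_const]

theorem gaussAverage_smul (t c : ℂ) (y : Fin d → ℂ) :
    gaussAverage μ r C t (c • y) = gaussAverage μ r C (t * c ^ 2) y := by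
  simp only [gaussAverage, quadForm_smul]
  congr! 3
  ring

theorem isSymm_diffusionMatrix (v : Fin d → ℝ) : (diffusionMatrix μ r C v).IsSymm :=
  Matrix.IsSymm.ext fun i j => diffusionMatrix_apply_comm v j i

namespace IsRandomUnitary

variable {μ r C} [IsProbabilityMeasure μ] [NeZero d] (hC : IsRandomUnitary C)
  (hS : AssumptionS μ r C)
include hC hS

theorem exists_gaussFamily_eq :
    ∃ A : Fin d → Fin d → (Fin d → ℝ) →ᵇ ℂ, ∀ p v, gaussFamily A p v
      = Complex.exp (-(p.1 / 2) * quadForm (diffusionMatrix μ r C v) p.2) := by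
  have hcont (i j : Fin d) : Continuous fun v => diffusionMatrix μ r C v i j :=
    (hC.continuous_diffusionMatrix hS).matrix_elem i j
  have hbound (i j : Fin d) : ∃ K, ∀ v, ‖diffusionMatrix μ r C v i j‖ ≤ K := by
    obtain ⟨K, hK⟩ := exists_forall_mem_torus_norm_le (hcont i j)
    refine ⟨K, fun v => ?_⟩
    obtain ⟨w, hw, hwv⟩ := exists_mem_torus_avgMatrix_eq μ r C v
    have heq : diffusionMatrix μ r C w = diffusionMatrix μ r C v := by
      simp only [diffusionMatrix, hwv]
    exact heq ▸ hK w hw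
  choose K hK using hbound
  exact ⟨fun i j => .ofNormedAddCommGroup _ (hcont i j) (K i j) (hK i j), gaussFamily_apply _⟩

theorem contDiff_gaussAverage :
    ContDiff ℂ ω fun p : ℂ × (Fin d → ℂ) => gaussAverage μ r C p.1 p.2 := by
  obtain ⟨A, hA⟩ := hC.exists_gaussFamily_eq hS
  simp only [gaussAverage, ← hA]
  exact torusIntCLM.contDiff.comp (contDiff_gaussFamily A)

theorem isEntireFamily_exp_quadForm : IsEntireFamily fun v y =>
    Complex.exp (-(1 / 2) * quadForm (diffusionMatrix μ r C v) y) := by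
  obtain ⟨A, hA⟩ := hC.exists_gaussFamily_eq hS
  exact ⟨fun y => gaussFamily A (1, y),
    (contDiff_gaussFamily A).comp (contDiff_const.prodMk contDiff_id), fun v y => hA (1, y) v⟩

theorem partialDeriv_partialDeriv_gaussAverage (i j : Fin d) :
    partialDeriv i (partialDeriv j (gaussAverage μ r C 1)) 0
      = -torusInt fun v => diffusionMatrix μ r C v i j := by
  have hfam := hC.isEntireFamily_exp_quadForm hS
  unfold gaussAverage
  rw [hfam.partialDeriv_torusInt j, (hfam.partialDeriv j).partialDeriv_torusInt i]
  simp only [partialDeriv_partialDeriv_exp_quadForm (isSymm_diffusionMatrix μ r C _)]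
  rw [← neg_one_mul, ← torusInt_const_mul]
  simp only [neg_one_mul]

end IsRandomUnitary

end GaussianAverage

section SmallFrequencies

open scoped Matrix.Norms.L2Operator

theorem tendsto_torusInt_zero {ι : Type*} {𝓕 : Filter ι} {d : ℕ} {f : ι → (Fin d → ℝ) → ℂ}
    (hf : Tendsto (fun p : ι × (Fin d → ℝ) => f p.1 p.2) (𝓕 ×ˢ 𝓟 (torus d)) (𝓝 0)) :
    Tendsto (fun i => torusInt (f i)) 𝓕 (𝓝 0) := by
  rw [Metric.tendsto_nhds] at hf ⊢
  intro ε hε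
  filter_upwards [eventually_prod_principal_iff.1 (hf (ε / 2) (half_pos hε))] with i hi
  rw [dist_zero_right]
  refine (norm_torusInt_le fun v hv => ?_).trans_lt (half_lt_self hε)
  simpa only [dist_zero_right] using (hi v hv).le

theorem isBigO_cexp_one {X : Type*} {𝓕 : Filter X} {f : X → ℂ} (hf : f =O[𝓕] fun _ => (1 : ℝ)) :
    (fun x => Complex.exp (f x)) =O[𝓕] fun _ => (1 : ℝ) := by
  obtain ⟨K, hK⟩ := hf.bound
  refine IsBigO.of_bound (Real.exp K) (hK.mono fun x hx => ?_)
  rw [norm_one, mul_one] at hx ⊢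
  exact (Complex.norm_exp_le_exp_norm _).trans (Real.exp_le_exp.2 hx)

namespace IsRandomUnitary

variable {d : ℕ} {Ω : Type*} [MeasurableSpace Ω] {μ : Measure Ω} {r : CoinIdx d → Fin d → ℤ}
  {C : Ω → Matrix (CoinIdx d) (CoinIdx d) ℂ} [IsProbabilityMeasure μ] [NeZero d]
  (hC : IsRandomUnitary C) (hS : AssumptionS μ r C) {ι : Type*} {𝓕 : Filter ι}
  {z : ι → Fin d → ℂ} {m : ι → ℕ}
include hC hS

theorem isBigO_quadForm_diffusionMatrix (𝓕 : Filter ι) (z : ι → Fin d → ℂ) :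
    (fun p : ι × (Fin d → ℝ) => quadForm (diffusionMatrix μ r C p.2) (z p.1))
      =O[𝓕 ×ˢ 𝓟 (torus d)] fun p => ‖z p.1‖ ^ 2 := by
  obtain ⟨K, hK⟩ := hC.exists_forall_norm_quadForm_diffusionMatrix_le hS
  refine IsBigO.of_bound K (eventually_prod_principal_iff.2 (Eventually.of_forall fun i v hv => ?_))
  simpa using hK v hv (z i)

theorem tendsto_projPsi_mul_pow (hz : Tendsto z 𝓕 (𝓝 0))
    (hm : (fun i => (m i : ℝ) * ‖z i‖ ^ 2) =O[𝓕] fun _ => (1 : ℝ)) :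
    Tendsto (fun p : ι × (Fin d → ℝ) => projPsi d *
      (Complex.exp (-(-(1 / 2) * quadForm (diffusionMatrix μ r C p.2) (z p.1))) •
        (centeredPhase r (z p.1) * avgMatrix μ r C (-p.2) p.2)) ^ m p.1)
      (𝓕 ×ˢ 𝓟 (torus d)) (𝓝 (projPsi d)) := by
  obtain ⟨N, hN, hQN⟩ := hC.exists_forall_norm_restMatrix_pow_le hS (δ := 1 / 4) (by norm_num)
  have hz' : Tendsto (fun p : ι × (Fin d → ℝ) => z p.1) (𝓕 ×ˢ 𝓟 (torus d)) (𝓝 0) :=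
    hz.comp tendsto_fst
  have hQ : (fun p : ι × (Fin d → ℝ) => restMatrix μ r C p.2) =O[𝓕 ×ˢ 𝓟 (torus d)]
      fun _ => (1 : ℝ) :=
    IsBigO.of_bound 1 (Eventually.of_forall fun p => by
      simpa using hC.norm_restMatrix_le_one p.2)
  have hHM (v : Fin d → ℝ) : corrector (avgMatrix μ r C (-v) v) (projPsi d)
      * (projPsi d + restMatrix μ r C v)
        = corrector (avgMatrix μ r C (-v) v) (projPsi d) - restMatrix μ r C v := by
    rw [projPsi_add_restMatrix]
    exact corrector_mul projPsi_mul_self (hC.avgMatrix_mul_projPsi v) (hC.projPsi_mul_avgMatrix v)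
      (hC.isUnit_restMatrix_sub_one hS v)
  have hW : (fun p : ι × (Fin d → ℝ) => centeredDiag r (z p.1)) =O[𝓕 ×ˢ 𝓟 (torus d)]
      fun p => ‖z p.1‖ := isBigO_centeredDiag r
  have hV : (fun p : ι × (Fin d → ℝ) =>
      (1 / 2 : ℂ) • (centeredDiag r (z p.1) * centeredDiag r (z p.1)))
        =O[𝓕 ×ˢ 𝓟 (torus d)] fun p => ‖z p.1‖ ^ 2 :=
    ((hW.mul hW).const_smul_left (1 / 2 : ℂ)).congr_right fun _ => (pow_two _).symm
  simp only [← projPsi_add_restMatrix]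
  exact tendsto_mul_exp_neg_smul_pow (by simpa using hz'.norm) (hm.comp_tendsto tendsto_fst)
    projPsi_mul_self (fun p => hC.projPsi_mul_restMatrix p.2)
    (fun p => hC.restMatrix_mul_projPsi p.2) hQ hN (fun p => hQN p.2)
    (isBigO_one_snd_of_continuous 𝓕 (hC.continuous_corrector hS)) (fun p => hHM p.2) hW hV
    (isBigO_centeredPhase_sub r hz') (fun p => projPsi_mul_centeredDiag_mul_projPsi r _)
    ((hC.isBigO_quadForm_diffusionMatrix hS 𝓕 z).const_mul_left _)
    (fun p => hC.projPsi_mul_second_order_mul_projPsi hS p.2 _)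

theorem tendsto_traceForm_pow_sub {φ₀ : CoinSpace d} (hφ₀ : ‖φ₀‖ = 1) (hz : Tendsto z 𝓕 (𝓝 0))
    (hm : (fun i => (m i : ℝ) * ‖z i‖ ^ 2) =O[𝓕] fun _ => (1 : ℝ)) :
    Tendsto (fun p : ι × (Fin d → ℝ) =>
      traceForm φ₀ ((centeredPhase r (z p.1) * avgMatrix μ r C (-p.2) p.2) ^ m p.1)
        - Complex.exp (-((m p.1 : ℂ) / 2) * quadForm (diffusionMatrix μ r C p.2) (z p.1)))
      (𝓕 ×ˢ 𝓟 (torus d)) (𝓝 0) := by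
  set q := fun p : ι × (Fin d → ℝ) => quadForm (diffusionMatrix μ r C p.2) (z p.1)
  have htrace : traceForm φ₀ (projPsi d) = 1 := by
    rw [← mul_one (projPsi d), traceForm_projPsi_mul, traceForm_one hφ₀]
  have hlim := ((traceForm φ₀).continuous_of_finiteDimensional.tendsto _).comp
    (hC.tendsto_projPsi_mul_pow hS hz hm)
  rw [htrace] at hlim
  have hexponent : (fun p : ι × (Fin d → ℝ) => -((m p.1 : ℂ) / 2) * q p)
      =O[𝓕 ×ˢ 𝓟 (torus d)] fun _ => (1 : ℝ) := by
    have hmq : (fun p : ι × (Fin d → ℝ) => (m p.1 : ℂ) * q p)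
        =O[𝓕 ×ˢ 𝓟 (torus d)] fun p => (m p.1 : ℝ) * ‖z p.1‖ ^ 2 :=
      (IsBigO.of_bound 1 (by simp)).mul (hC.isBigO_quadForm_diffusionMatrix hS 𝓕 z)
    exact ((hmq.trans (hm.comp_tendsto tendsto_fst)).const_mul_left (-(1 / 2))).congr_left
      fun p => by ring
  rw [← isLittleO_one_iff ℝ]
  have hsmall := (isBigO_cexp_one hexponent).mul_isLittleO
    ((isLittleO_one_iff ℝ).2 (tendsto_sub_nhds_zero_iff.2 hlim))
  refine hsmall.congr (fun p => ?_) fun _ => mul_one 1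
  have hcancel : (m p.1 : ℂ) * -(-(1 / 2) * q p) = -(-((m p.1 : ℂ) / 2) * q p) := by ring
  rw [Function.comp_apply, traceForm_projPsi_mul, smul_pow, map_smul, smul_eq_mul,
    ← Complex.exp_nat_mul, hcancel, mul_sub, mul_one, ← mul_assoc, ← Complex.exp_add,
    add_neg_cancel, Complex.exp_zero, one_mul]

theorem tendsto_exp_mul_charFn_sub {φ₀ : CoinSpace d} (hφ₀ : ‖φ₀‖ = 1) (hz : Tendsto z 𝓕 (𝓝 0))
    (hm : (fun i => (m i : ℝ) * ‖z i‖ ^ 2) =O[𝓕] fun _ => (1 : ℝ)) :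
    Tendsto (fun i => Complex.exp (-(Complex.I * m i * (z i ⬝ᵥ fun j => (meanJump r j : ℂ))))
      * charFn μ r C φ₀ (m i) (z i) - gaussAverage μ r C (m i) (z i)) 𝓕 (𝓝 0) := by
  have heq (i : ι) : Complex.exp (-(Complex.I * m i * (z i ⬝ᵥ fun j => (meanJump r j : ℂ))))
      * charFn μ r C φ₀ (m i) (z i) - gaussAverage μ r C (m i) (z i)
        = torusInt fun v => traceForm φ₀ ((centeredPhase r (z i) * avgMatrix μ r C (-v) v) ^ m i)
          - Complex.exp (-((m i : ℂ) / 2) * quadForm (diffusionMatrix μ r C v) (z i)) := by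
    rw [hC.exp_mul_charFn_eq_torusInt μ r φ₀, gaussAverage, ← torusInt_sub]
    · exact (traceForm φ₀).continuous_of_finiteDimensional.comp
        ((continuous_const.mul continuous_avgMatrix_neg_self).pow _)
    · exact (continuous_const.mul (hC.continuous_quadForm_diffusionMatrix hS _)).cexp
  simp only [heq]
  exact tendsto_torusInt_zero (hC.tendsto_traceForm_pow_sub hS hφ₀ hz hm)

end IsRandomUnitary

end SmallFrequencies

section ScalingLimits

theorem tendstoUniformlyOn_of_forall_tendsto {ι α β : Type*} [TopologicalSpace α] [UniformSpace β]
    {F : ι → α → β} {f : α → β} {p : Filter ι} {s : Set α} (hs : IsCompact s)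
    (hf : ContinuousOn f s)
    (hF : ∀ x ∈ s, Tendsto (fun q : ι × α => F q.1 q.2) (p ×ˢ 𝓝[s] x) (𝓝 (f x))) :
    TendstoUniformlyOn F f p s := by
  rw [← tendstoLocallyUniformlyOn_iff_tendstoUniformlyOn_of_compact hs,
    tendstoLocallyUniformlyOn_iff_forall_tendsto]
  intro x hx
  exact (((hf x hx).tendsto.comp tendsto_snd).prodMk_nhds (hF x hx)).mono_right
    (nhds_le_uniformity (f x))

theorem tendsto_natFloor_mul_div {t : ℝ} (ht : 0 ≤ t) :
    Tendsto (fun q : ℕ × ℝ => (⌊q.2 * q.1⌋₊ : ℝ) / q.1) (atTop ×ˢ 𝓝 t) (𝓝 t) := by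
  have hpos : ∀ᶠ q : ℕ × ℝ in atTop ×ˢ 𝓝 t, (0 : ℝ) < q.1 :=
    tendsto_fst.eventually ((eventually_gt_atTop 0).mono fun n hn => Nat.cast_pos.2 hn)
  have hlower : Tendsto (fun q : ℕ × ℝ => q.2 - 1 / (q.1 : ℝ)) (atTop ×ˢ 𝓝 t) (𝓝 t) := by
    simpa using (tendsto_snd (g := 𝓝 t)).sub
      ((tendsto_one_div_atTop_nhds_zero_nat (𝕜 := ℝ)).comp (tendsto_fst (g := 𝓝 t)))
  have hupper : Tendsto (fun q : ℕ × ℝ => max q.2 0) (atTop ×ˢ 𝓝 t) (𝓝 t) := by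
    simpa [ht] using (tendsto_snd (f := (atTop : Filter ℕ)) (g := 𝓝 t)).max
      (tendsto_const_nhds (x := (0 : ℝ)))
  refine tendsto_of_tendsto_of_tendsto_of_le_of_le' hlower hupper ?_ ?_
  · filter_upwards [hpos] with q hq
    rw [le_div_iff₀ hq, sub_mul, one_div_mul_cancel hq.ne']
    exact (Nat.sub_one_lt_floor _).le
  · filter_upwards [hpos] with q hq
    rw [div_le_iff₀ hq]
    have hle : ⌊q.2 * q.1⌋₊ ≤ ⌊max q.2 0 * q.1⌋₊ := by gcongr; exact le_max_left _ _
    exact (Nat.cast_le.2 hle).trans (Nat.floor_le (by positivity))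

theorem tendsto_natFloor_mul_mul_inv {E : Type*} [TopologicalSpace E] {t : ℝ} (ht : 0 ≤ t) (y : E) :
    Tendsto (fun q : ℕ × ℝ × E => (⌊q.2.1 * q.1⌋₊ : ℂ) * (q.1 : ℂ)⁻¹) (atTop ×ˢ 𝓝 (t, y))
      (𝓝 (t : ℂ)) := by
  have hfloor := (tendsto_natFloor_mul_div ht).comp
    (tendsto_fst.prodMk (tendsto_snd (f := (atTop : Filter ℕ)) (g := 𝓝 (t, y))).fst_nhds)
  exact hfloor.ofReal.congr fun q => by simp [div_eq_mul_inv]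

variable {d : ℕ} {Ω : Type*} [MeasurableSpace Ω] (μ : Measure Ω) [IsProbabilityMeasure μ]
  (r : CoinIdx d → Fin d → ℤ) (C : Ω → Matrix (CoinIdx d) (CoinIdx d) ℂ) (φ₀ : CoinSpace d)

/-- The averaged characteristic function of `ε (X - b)` at time `n`. -/
noncomputable def scaledCharFn (n : ℕ) (b : Fin d → ℝ) (ε : ℂ) (y : Fin d → ℂ) : ℂ :=
  Complex.exp (-(Complex.I * ε * ∑ j, y j * (b j : ℂ))) * charFn μ r C φ₀ n (ε • y)

theorem scaledCharFn_zero (n : ℕ) (ε : ℂ) (y : Fin d → ℂ) :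
    scaledCharFn μ r C φ₀ n 0 ε y = charFn μ r C φ₀ n (ε • y) := by
  simp [scaledCharFn]

theorem scaledCharFn_nsmul (n : ℕ) (b : Fin d → ℝ) (ε : ℂ) (y : Fin d → ℂ) :
    scaledCharFn μ r C φ₀ n (n • b) ε y
      = Complex.exp (-(Complex.I * n * ((ε • y) ⬝ᵥ fun j => (b j : ℂ))))
        * charFn μ r C φ₀ n (ε • y) := by
  rw [scaledCharFn, smul_dotProduct, dotProduct]
  congr 3
  simp only [Pi.smul_apply, nsmul_eq_mul, Complex.ofReal_mul, Complex.ofReal_natCast,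
    Finset.mul_sum, smul_eq_mul]
  exact Finset.sum_congr rfl fun j _ => by ring

theorem scaledCharFn_zero_eq_exp_mul (n : ℕ) (b : Fin d → ℝ) (ε : ℂ) (y : Fin d → ℂ) :
    scaledCharFn μ r C φ₀ n 0 ε y = Complex.exp (Complex.I * (n * ε) * ∑ j, y j * (b j : ℂ))
      * scaledCharFn μ r C φ₀ n (n • b) ε y := by
  rw [scaledCharFn_zero, scaledCharFn_nsmul, ← mul_assoc, ← Complex.exp_add, smul_dotProduct,
    dotProduct, smul_eq_mul]
  ring_nf
  simp

namespace IsRandomUnitary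

variable {μ r C φ₀} [NeZero d] (hC : IsRandomUnitary C) (hS : AssumptionS μ r C) (hφ₀ : ‖φ₀‖ = 1)
include hC hS hφ₀

theorem tendsto_scaledCharFn {ι : Type*} {𝓕 : Filter ι} {m : ι → ℕ} {ε : ι → ℂ}
    {y : ι → Fin d → ℂ} {s : ℂ} {y₀ : Fin d → ℂ} (hε : Tendsto ε 𝓕 (𝓝 0))
    (hmε : Tendsto (fun i => (m i : ℂ) * ε i ^ 2) 𝓕 (𝓝 s)) (hy : Tendsto y 𝓕 (𝓝 y₀)) :
    Tendsto (fun i => scaledCharFn μ r C φ₀ (m i) (m i • meanJump r) (ε i) (y i)) 𝓕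
      (𝓝 (gaussAverage μ r C s y₀)) := by
  have hz : Tendsto (fun i => ε i • y i) 𝓕 (𝓝 0) := by simpa using hε.smul hy
  have hm : (fun i => (m i : ℝ) * ‖ε i • y i‖ ^ 2) =O[𝓕] fun _ => (1 : ℝ) :=
    ((hmε.norm.mul (hy.norm.pow 2)).congr fun i => by
      simp only [norm_mul, norm_pow, norm_smul, Complex.norm_natCast]; ring).isBigO_one ℝ
  have hlim : Tendsto (fun i => gaussAverage μ r C (m i) (ε i • y i)) 𝓕
      (𝓝 (gaussAverage μ r C s y₀)) := by
    simp only [gaussAverage_smul]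
    have hcont : Continuous fun p : ℂ × (Fin d → ℂ) => gaussAverage μ r C p.1 p.2 :=
      (hC.contDiff_gaussAverage hS).continuous
    have hpair : Tendsto (fun i => ((m i : ℂ) * ε i ^ 2, y i)) 𝓕 (𝓝 (s, y₀)) :=
      hmε.prodMk_nhds hy
    have h := (hcont.tendsto (s, y₀)).comp hpair
    simpa only [Function.comp_def] using h
  have hsum := (hC.tendsto_exp_mul_charFn_sub hS hφ₀ hz hm).add hlim
  simpa only [← scaledCharFn_nsmul, sub_add_cancel, zero_add] using hsum

theorem tendstoUniformlyOn_scaledCharFn_inv_sqrt {G : Set ℝ} {K : Set (Fin d → ℂ)}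
    (hG : IsCompact G) (hG0 : G ⊆ Set.Ici 0) (hK : IsCompact K) :
    TendstoUniformlyOn (fun (n : ℕ) (p : ℝ × (Fin d → ℂ)) =>
      scaledCharFn μ r C φ₀ ⌊p.1 * n⌋₊ (⌊p.1 * n⌋₊ • meanJump r) (Real.sqrt n : ℂ)⁻¹ p.2)
      (fun p => gaussAverage μ r C p.1 p.2) atTop (G ×ˢ K) := by
  have hcont : Continuous fun p : ℂ × (Fin d → ℂ) => gaussAverage μ r C p.1 p.2 :=
    (hC.contDiff_gaussAverage hS).continuous
  have hcont' : Continuous fun p : ℝ × (Fin d → ℂ) => gaussAverage μ r C p.1 p.2 :=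
    hcont.comp (by fun_prop : Continuous fun p : ℝ × (Fin d → ℂ) => ((p.1 : ℂ), p.2))
  refine tendstoUniformlyOn_of_forall_tendsto (hG.prod hK) hcont'.continuousOn
    fun ⟨t, y⟩ hty => Tendsto.mono_left ?_ (prod_mono_right _ nhdsWithin_le_nhds)
  refine hC.tendsto_scaledCharFn hS hφ₀ ?_ ?_ (tendsto_snd.snd_nhds)
  · have hsqrt : Tendsto (fun n : ℕ => (Real.sqrt n : ℂ)⁻¹) atTop (𝓝 0) := by
      simpa using (tendsto_inv_atTop_zero.comp
        (Real.tendsto_sqrt_atTop.comp tendsto_natCast_atTop_atTop)).ofReal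
    exact hsqrt.comp tendsto_fst
  · refine (tendsto_natFloor_mul_mul_inv (hG0 hty.1) y).congr fun q => ?_
    simp [← Complex.ofReal_pow]

theorem tendstoUniformlyOn_scaledCharFn_inv {G : Set ℝ} {K : Set (Fin d → ℂ)}
    (hG : IsCompact G) (hG0 : G ⊆ Set.Ici 0) (hK : IsCompact K) :
    TendstoUniformlyOn (fun (n : ℕ) (p : ℝ × (Fin d → ℂ)) =>
      scaledCharFn μ r C φ₀ ⌊p.1 * n⌋₊ 0 (n : ℂ)⁻¹ p.2)
      (fun p => Complex.exp (Complex.I * p.1 * ∑ j, p.2 j * (meanJump r j : ℂ)))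
      atTop (G ×ˢ K) := by
  refine tendstoUniformlyOn_of_forall_tendsto (hG.prod hK) (Continuous.continuousOn (by fun_prop))
    fun ⟨t, y⟩ hty => Tendsto.mono_left ?_ (prod_mono_right _ nhdsWithin_le_nhds)
  have hdrift := tendsto_natFloor_mul_mul_inv (hG0 hty.1) y
  have hinv : Tendsto (fun q : ℕ × ℝ × (Fin d → ℂ) => (q.1 : ℂ)⁻¹) (atTop ×ˢ 𝓝 (t, y)) (𝓝 0) :=
    (tendsto_inv_atTop_nhds_zero_nat (𝕜 := ℂ)).comp tendsto_fst
  have hspread := hC.tendsto_scaledCharFn hS hφ₀ hinv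
    ((hdrift.mul hinv).congr fun q => by ring) tendsto_snd.snd_nhds
  have hexp : Tendsto (fun q : ℕ × ℝ × (Fin d → ℂ) => Complex.exp (Complex.I *
      (⌊q.2.1 * q.1⌋₊ * (q.1 : ℂ)⁻¹) * ∑ j, q.2.2 j * (meanJump r j : ℂ))) (atTop ×ˢ 𝓝 (t, y))
      (𝓝 (Complex.exp (Complex.I * t * ∑ j, y j * (meanJump r j : ℂ)))) :=
    ((hdrift.const_mul Complex.I).mul (tendsto_finsetSum _ fun j _ =>
      (tendsto_snd.snd_nhds.apply_nhds j).mul_const _)).cexp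
  have hprod := hexp.mul hspread
  simp only [mul_zero, gaussAverage_zero_left, mul_one] at hprod
  exact hprod.congr fun q => (scaledCharFn_zero_eq_exp_mul μ r C φ₀ _ _ _ _).symm

end IsRandomUnitary

end ScalingLimits

section ExponentialSums

open scoped ContDiff

variable {d : ℕ} {ι : Type*} (F : Finset ι) (a : ι → Fin d → ℂ) (c : ι → ℂ)

/-- The exponential sum `∑ₖ cₖ e^{y·aₖ}` over `k ∈ F`. -/
noncomputable def expSum (y : Fin d → ℂ) : ℂ := ∑ k ∈ F, c k * Complex.exp (y ⬝ᵥ a k)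

theorem expSum_zero : expSum F a c 0 = ∑ k ∈ F, c k := by simp [expSum]

theorem contDiff_expSum : ContDiff ℂ ω (expSum F a c) := by
  unfold expSum dotProduct
  fun_prop

theorem partialDeriv_expSum (j : Fin d) :
    partialDeriv j (expSum F a c) = expSum F a fun k => c k * a k j := by
  ext y
  have hline (k : ι) : HasDerivAt (fun w : ℂ => (y + w • Pi.single j 1) ⬝ᵥ a k) (a k j) 0 := by
    simp only [add_dotProduct, smul_dotProduct, single_one_dotProduct, smul_eq_mul]
    exact (hasDerivAt_mul_const (a k j)).const_add _
  have hsum : HasDerivAt (fun w : ℂ => expSum F a c (y + w • Pi.single j 1))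
      (expSum F a (fun k => c k * a k j) y) 0 := by
    refine (HasDerivAt.fun_sum fun k _ => ((hline k).cexp.const_mul (c k))).congr_deriv ?_
    simp only [expSum, zero_smul, add_zero]
    exact Finset.sum_congr rfl fun k _ => by ring
  exact (((contDiff_expSum F a c).differentiable (by simp) y).hasFDerivAt.hasLineDerivAt _).unique
    hsum

theorem iterate_mul_apply {M : Type*} [Monoid M] (x c : ι → M) (n : ℕ) (k : ι) :
    ((fun c k => c k * x k)^[n] c) k = c k * x k ^ n := by
  induction n generalizing c with
  | zero => simp
  | succ n ih => rw [Function.iterate_succ_apply, ih, pow_succ', mul_assoc]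

theorem mixedDeriv_expSum (s : Fin d → ℕ) :
    mixedDeriv s (expSum F a c) = expSum F a fun k => c k * ∏ j, a k j ^ s j := by
  have hcoeff (l : List (Fin d)) : l.foldr (fun j => (fun c k => c k * a k j)^[s j]) c
      = fun k => c k * (l.map fun j => a k j ^ s j).prod := by
    induction l with
    | nil => simp
    | cons j l ih =>
      ext k
      rw [List.foldr_cons, iterate_mul_apply (a · j), ih, List.map_cons, List.prod_cons]
      ring
  have hfold := foldr_iterate_rel partialDeriv (fun j c k => c k * a k j)
    (fun g c => g = expSum F a c) (fun j _ c hg => hg ▸ partialDeriv_expSum F a c j) s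
    (List.finRange d) (a := expSum F a c) (b := c) rfl
  rw [mixedDeriv, hfold, hcoeff]
  simp only [Fin.prod_univ_def]

end ExponentialSums

section Moments

variable {d : ℕ} {Ω : Type*} [MeasurableSpace Ω] (μ : Measure Ω) [IsProbabilityMeasure μ]
  (r : CoinIdx d → Fin d → ℤ) (C : Ω → Matrix (CoinIdx d) (CoinIdx d) ℂ) (φ₀ : CoinSpace d)

open scoped ContDiff

theorem exists_finset_avgProb_eq_zero (n : ℕ) :
    ∃ F : Finset (Fin d → ℤ), ∀ k ∉ F, avgProb μ r C φ₀ n k = 0 := by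
  obtain ⟨F, hF⟩ := exists_finset_prob_eq_zero r φ₀ n
  exact ⟨F, fun k hk => by simp only [avgProb, hF _ k hk, integral_zero]⟩

variable {μ r C φ₀} in
theorem avgExp_eq_sum {n : ℕ} {F : Finset (Fin d → ℤ)} (hF : ∀ k ∉ F, avgProb μ r C φ₀ n k = 0)
    (f : (Fin d → ℤ) → ℝ) : avgExp μ r C φ₀ n f = ∑ k ∈ F, f k * avgProb μ r C φ₀ n k :=
  tsum_eq_sum fun k hk => by rw [hF k hk, mul_zero]

variable {μ r C φ₀} in
theorem scaledCharFn_eq_expSum {n : ℕ} {F : Finset (Fin d → ℤ)}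
    (hF : ∀ k ∉ F, avgProb μ r C φ₀ n k = 0) (b : Fin d → ℝ) (ε : ℂ) :
    scaledCharFn μ r C φ₀ n b ε = expSum F
      (fun k j => Complex.I * ε * (((k j : ℝ) - b j : ℝ) : ℂ)) fun k => avgProb μ r C φ₀ n k := by
  ext y
  rw [scaledCharFn, charFn, tsum_eq_sum fun k hk => by rw [hF k hk, Complex.ofReal_zero, zero_mul],
    expSum, Finset.mul_sum]
  refine Finset.sum_congr rfl fun k _ => ?_
  rw [mul_left_comm, ← Complex.exp_add, dotProduct, Finset.mul_sum, Finset.mul_sum,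
    ← Finset.sum_neg_distrib, ← Finset.sum_add_distrib]
  congr 2
  refine Finset.sum_congr rfl fun j _ => ?_
  simp only [Pi.smul_apply, smul_eq_mul]
  push_cast
  ring

theorem contDiff_scaledCharFn (n : ℕ) (b : Fin d → ℝ) (ε : ℂ) :
    ContDiff ℂ ω (scaledCharFn μ r C φ₀ n b ε) := by
  obtain ⟨F, hF⟩ := exists_finset_avgProb_eq_zero μ r C φ₀ n
  exact scaledCharFn_eq_expSum hF b ε ▸ contDiff_expSum F _ _

theorem mixedDeriv_scaledCharFn_zero (n : ℕ) (b : Fin d → ℝ) (ε : ℂ) (s : Fin d → ℕ) :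
    mixedDeriv s (scaledCharFn μ r C φ₀ n b ε) 0
      = (Complex.I * ε) ^ (∑ j, s j) * avgExp μ r C φ₀ n fun k => ∏ j, ((k j : ℝ) - b j) ^ s j := by
  obtain ⟨F, hF⟩ := exists_finset_avgProb_eq_zero μ r C φ₀ n
  rw [scaledCharFn_eq_expSum hF, mixedDeriv_expSum, expSum_zero, avgExp_eq_sum hF,
    Complex.ofReal_sum, Finset.mul_sum]
  refine Finset.sum_congr rfl fun k _ => ?_
  simp only [mul_pow _ (Complex.ofReal _), Finset.prod_mul_distrib, Finset.prod_pow_eq_pow_sum]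
  push_cast
  ring

theorem partialDeriv_partialDeriv_scaledCharFn_zero (n : ℕ) (b : Fin d → ℝ) (ε : ℂ) (i j : Fin d) :
    partialDeriv i (partialDeriv j (scaledCharFn μ r C φ₀ n b ε)) 0
      = -ε ^ 2 * avgExp μ r C φ₀ n fun k => ((k i : ℝ) - b i) * ((k j : ℝ) - b j) := by
  obtain ⟨F, hF⟩ := exists_finset_avgProb_eq_zero μ r C φ₀ n
  rw [scaledCharFn_eq_expSum hF, partialDeriv_expSum, partialDeriv_expSum, expSum_zero,
    avgExp_eq_sum hF, Complex.ofReal_sum, Finset.mul_sum]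
  refine Finset.sum_congr rfl fun k _ => ?_
  push_cast
  linear_combination (avgProb μ r C φ₀ n k * ε ^ 2 * ((k j : ℂ) - b j) * ((k i : ℂ) - b i))
    * Complex.I_sq

theorem neg_I_pow_mul_I_pow (n : ℕ) : (-Complex.I) ^ n * Complex.I ^ n = 1 := by
  rw [← mul_pow, neg_mul, Complex.I_mul_I, neg_neg, one_pow]

namespace IsRandomUnitary

variable {μ r C φ₀} [NeZero d] (hC : IsRandomUnitary C) (hS : AssumptionS μ r C) (hφ₀ : ‖φ₀‖ = 1)
include hC hS hφ₀

theorem entireTendsto_scaledCharFn_inv :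
    EntireTendsto (fun n : ℕ => scaledCharFn μ r C φ₀ n 0 (n : ℂ)⁻¹) atTop
      (expSum {()} (fun _ j => Complex.I * (meanJump r j : ℂ)) 1) := by
  refine ⟨fun n => contDiff_scaledCharFn μ r C φ₀ n 0 _, contDiff_expSum _ _ _, fun {K} hK => ?_⟩
  have hunif := (hC.tendstoUniformlyOn_scaledCharFn_inv hS hφ₀ (isCompact_singleton (x := (1 : ℝ)))
    (by simp) hK).comp fun y : Fin d → ℂ => ((1 : ℝ), y)
  simpa [expSum, dotProduct, Function.comp_def, Finset.mul_sum, mul_left_comm, funext_iff,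
    TendstoUniformlyOn] using hunif

theorem entireTendsto_scaledCharFn_inv_sqrt :
    EntireTendsto (fun n : ℕ => scaledCharFn μ r C φ₀ n (n • meanJump r) (Real.sqrt n : ℂ)⁻¹) atTop
      (gaussAverage μ r C 1) := by
  have hone : ContDiff ℂ ω fun y : Fin d → ℂ => ((1 : ℂ), y) := contDiff_const.prodMk contDiff_id
  have hgauss := (hC.contDiff_gaussAverage hS).comp hone
  refine ⟨fun n => contDiff_scaledCharFn μ r C φ₀ n _ _, hgauss, fun {K} hK => ?_⟩
  have hunif := (hC.tendstoUniformlyOn_scaledCharFn_inv_sqrt hS hφ₀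
    (isCompact_singleton (x := (1 : ℝ))) (by simp) hK).comp fun y : Fin d → ℂ => ((1 : ℝ), y)
  simpa [Function.comp_def, TendstoUniformlyOn] using hunif

theorem tendsto_avgExp_prod_pow (s : Fin d → ℕ) :
    Tendsto (fun n : ℕ => avgExp μ r C φ₀ n (fun k => ∏ j, (k j : ℝ) ^ s j) / (n : ℝ) ^ (∑ j, s j))
      atTop (𝓝 (∏ j, meanJump r j ^ s j)) := by
  have hlim := ((hC.entireTendsto_scaledCharFn_inv hS hφ₀).tendsto_mixedDeriv s 0).const_mul
    ((-Complex.I) ^ ∑ j, s j)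
  simp only [mixedDeriv_expSum, expSum_zero, mixedDeriv_scaledCharFn_zero, mul_pow Complex.I,
    Finset.prod_mul_distrib, Finset.prod_pow_eq_pow_sum, Finset.sum_singleton, Pi.one_apply,
    one_mul, Pi.zero_apply, sub_zero, ← mul_assoc, neg_I_pow_mul_I_pow] at hlim
  rw [← tendsto_ofReal_iff]
  push_cast
  exact hlim.congr fun n => by rw [inv_pow, inv_mul_eq_div]

theorem tendsto_avgExp_apply (i : Fin d) :
    Tendsto (fun n : ℕ => avgExp μ r C φ₀ n (fun k => (k i : ℝ)) / n) atTop
      (𝓝 (meanJump r i)) := by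
  have hprod (f : Fin d → ℝ) : ∏ j, f j ^ (Pi.single i 1 : Fin d → ℕ) j = f i := by
    simp [Pi.single_apply]
  simpa only [hprod, Finset.sum_pi_single', Finset.mem_univ, if_true, pow_one]
    using hC.tendsto_avgExp_prod_pow hS hφ₀ (Pi.single i 1)

theorem tendsto_avgExp_centered_mul (i j : Fin d) :
    Tendsto (fun n : ℕ => ((avgExp μ r C φ₀ n (fun k =>
        ((k i : ℝ) - n * meanJump r i) * ((k j : ℝ) - n * meanJump r j)) / n : ℝ) : ℂ))
      atTop (𝓝 (torusInt fun v => diffusionMatrix μ r C v i j)) := by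
  have hlim := (((hC.entireTendsto_scaledCharFn_inv_sqrt hS hφ₀).partialDeriv j).partialDeriv
    i).tendsto 0
  rw [hC.partialDeriv_partialDeriv_gaussAverage hS] at hlim
  refine neg_neg (torusInt _) ▸ hlim.neg.congr fun n => ?_
  rw [partialDeriv_partialDeriv_scaledCharFn_zero, inv_pow, ← Complex.ofReal_pow,
    Real.sq_sqrt n.cast_nonneg, neg_mul, neg_neg, inv_mul_eq_div]
  simp

theorem tendsto_avgExp_centered_prod_pow (s : Fin d → ℕ) :
    Tendsto (fun n : ℕ => ((avgExp μ r C φ₀ n (fun k =>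
        ∏ j, ((k j : ℝ) - n * meanJump r j) ^ s j) / (Real.sqrt n) ^ (∑ j, s j) : ℝ) : ℂ))
      atTop (𝓝 ((-Complex.I) ^ (∑ j, s j) * torusInt fun v =>
        mixedDeriv s (fun y => Complex.exp (-(1 / 2) *
          quadForm (diffusionMatrix μ r C v) y)) 0)) := by
  have hlim := ((hC.entireTendsto_scaledCharFn_inv_sqrt hS hφ₀).tendsto_mixedDeriv s 0).const_mul
    ((-Complex.I) ^ ∑ j, s j)
  unfold gaussAverage at hlim
  rw [(hC.isEntireFamily_exp_quadForm hS).mixedDeriv_torusInt] at hlim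
  refine hlim.congr fun n => ?_
  rw [mixedDeriv_scaledCharFn_zero, mul_pow, ← mul_assoc, ← mul_assoc, neg_I_pow_mul_I_pow, one_mul,
    inv_pow, inv_mul_eq_div]
  simp

end IsRandomUnitary

end Moments

theorem dim_ne_zero_of_norm_eq_one {d : ℕ} {φ : CoinSpace d} (hφ : ‖φ‖ = 1) : d ≠ 0 := by
  rintro rfl
  rw [Subsingleton.elim φ 0, norm_zero] at hφ
  exact zero_ne_one hφ

theorem inv_smul_eq_div {d : ℕ} (c : ℂ) (y : Fin d → ℂ) : c⁻¹ • y = fun j => y j / c := by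
  ext j
  rw [Pi.smul_apply, smul_eq_mul, inv_mul_eq_div]

theorem div_dotProduct {d : ℕ} (c : ℂ) (y b : Fin d → ℂ) :
    (fun j => y j / c) ⬝ᵥ b = (∑ j, b j * y j) / c := by
  rw [dotProduct, Finset.sum_div]
  exact Finset.sum_congr rfl fun j _ => by ring

end RandomQW

theorem mainTheorem1 {d : ℕ} {Ω : Type*} [MeasurableSpace Ω]
    (μ : Measure Ω) [IsProbabilityMeasure μ]
    (r : RandomQW.CoinIdx d → Fin d → ℤ)
    (C : Ω → Matrix (RandomQW.CoinIdx d) (RandomQW.CoinIdx d) ℂ)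
    (hC_unitary : ∀ ω, C ω ∈ Matrix.unitaryGroup (RandomQW.CoinIdx d) ℂ)
    (hC_meas : ∀ σ τ, Measurable fun ω => C ω σ τ)
    (φ₀ : RandomQW.CoinSpace d) (hφ₀ : ‖φ₀‖ = 1)
    (hS : RandomQW.AssumptionS μ r C) :
    -- ballistic scaling of the characteristic function
    (∀ (G : Set ℝ) (K : Set (Fin d → ℂ)), IsCompact G → G ⊆ Set.Ioi 0 → IsCompact K →
      TendstoUniformlyOn
        (fun (n : ℕ) (p : ℝ × (Fin d → ℂ)) =>
          RandomQW.charFn μ r C φ₀ ⌊p.1 * n⌋₊ (fun j => p.2 j / (n : ℂ)))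
        (fun p => Complex.exp
          (Complex.I * (p.1 : ℂ) * ∑ j, p.2 j * (RandomQW.meanJump r j : ℂ)))
        atTop (G ×ˢ K)) ∧
    -- diffusive scaling of the characteristic function
    (∀ (G : Set ℝ) (K : Set (Fin d → ℂ)), IsCompact G → G ⊆ Set.Ioi 0 → IsCompact K →
      TendstoUniformlyOn
        (fun (n : ℕ) (p : ℝ × (Fin d → ℂ)) =>
          Complex.exp (-(Complex.I * (⌊p.1 * n⌋₊ : ℂ) *
              ((∑ j, (RandomQW.meanJump r j : ℂ) * p.2 j) / (Real.sqrt n : ℂ)))) *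
            RandomQW.charFn μ r C φ₀ ⌊p.1 * n⌋₊ (fun j => p.2 j / (Real.sqrt n : ℂ)))
        (fun p => RandomQW.torusInt fun v =>
          Complex.exp (-((p.1 : ℂ) / 2) *
            RandomQW.quadForm (RandomQW.diffusionMatrix μ r C v) p.2))
        atTop (G ×ˢ K)) ∧
    -- the right-hand side is analytic in `(t, y)`
    AnalyticOnNhd ℂ
      (fun p : ℂ × (Fin d → ℂ) => RandomQW.torusInt fun v =>
        Complex.exp (-(p.1 / 2) *
          RandomQW.quadForm (RandomQW.diffusionMatrix μ r C v) p.2)) Set.univ ∧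
    -- first moments
    (∀ i : Fin d, Tendsto
      (fun n : ℕ => RandomQW.avgExp μ r C φ₀ n (fun k => (k i : ℝ)) / n)
      atTop (𝓝 (RandomQW.meanJump r i))) ∧
    -- centered second moments
    (∀ i j : Fin d, Tendsto
      (fun n : ℕ => ((RandomQW.avgExp μ r C φ₀ n (fun k =>
        ((k i : ℝ) - n * RandomQW.meanJump r i) * ((k j : ℝ) - n * RandomQW.meanJump r j)) / n
          : ℝ) : ℂ))
      atTop (𝓝 (RandomQW.torusInt fun v => RandomQW.diffusionMatrix μ r C v i j))) ∧
    -- all moments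
    (∀ s : Fin d → ℕ, Tendsto
      (fun n : ℕ => RandomQW.avgExp μ r C φ₀ n (fun k => ∏ j, (k j : ℝ) ^ s j)
        / (n : ℝ) ^ (∑ j, s j))
      atTop (𝓝 (∏ j, RandomQW.meanJump r j ^ s j))) ∧
    -- all centered moments
    (∀ s : Fin d → ℕ, Tendsto
      (fun n : ℕ => ((RandomQW.avgExp μ r C φ₀ n (fun k =>
        ∏ j, ((k j : ℝ) - n * RandomQW.meanJump r j) ^ s j)
          / (Real.sqrt n) ^ (∑ j, s j) : ℝ) : ℂ))
      atTop (𝓝 ((-Complex.I) ^ (∑ j, s j) * RandomQW.torusInt fun v =>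
        RandomQW.mixedDeriv s (fun y => Complex.exp (-(1 / 2) *
          RandomQW.quadForm (RandomQW.diffusionMatrix μ r C v) y)) 0))) := by
  have : NeZero d := ⟨RandomQW.dim_ne_zero_of_norm_eq_one hφ₀⟩
  have hC : RandomQW.IsRandomUnitary C := ⟨hC_unitary, hC_meas⟩
  have hIci {G : Set ℝ} (hG : G ⊆ Set.Ioi 0) : G ⊆ Set.Ici 0 := hG.trans Set.Ioi_subset_Ici_self
  refine ⟨fun G K hG hG0 hK => ?_, fun G K hG hG0 hK => ?_,
    contDiff_omega_iff_analyticOnNhd.1 (hC.contDiff_gaussAverage hS),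
    hC.tendsto_avgExp_apply hS hφ₀, hC.tendsto_avgExp_centered_mul hS hφ₀,
    hC.tendsto_avgExp_prod_pow hS hφ₀, hC.tendsto_avgExp_centered_prod_pow hS hφ₀⟩
  · simpa only [RandomQW.scaledCharFn_zero, RandomQW.inv_smul_eq_div]
      using hC.tendstoUniformlyOn_scaledCharFn_inv hS hφ₀ hG (hIci hG0) hK
  · simpa only [RandomQW.scaledCharFn_nsmul, RandomQW.inv_smul_eq_div, RandomQW.div_dotProduct,
      RandomQW.gaussAverage]
      using hC.tendstoUniformlyOn_scaledCharFn_inv_sqrt hS hφ₀ hG (hIci hG0) hK
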